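/- **Language (Polarized SILL).** Session types $\Xi\vdash A\ \mathsf{type}^p$ ($p\in\{-,+\}$; $\Xi$ a list of polarized type variables) are $\mathbf 1$, ${\downarrow}A^-$, $\oplus\{l:A_l^+\}_{l\in L}$, $A^+\otimes B^+$, $\tau\wedge A^+$ (positive); ${\uparrow}A^+$, $\&\{l:A_l^-\}_{l\in L}$, $A^+\multimap B^-$, $\tau\supset A^-$ (negative), with $L$ finite; variables $\alpha^p$; and $\rho\alpha.A$, of polarity $p$ whenever $\Xi,\alpha^p\vdash A\ \mathsf{type}^p$. Functional types $\tau$ are $\tau\to\sigma$ and the types $\{a:A\leftarrow a_1:A_1,\dots,a_n:A_n\}$ of quoted processes ($A,A_i$ closed). Terms $\Psi\vdash M:\tau$ are those of the simply typed $\lambda$-calculus with a fixed-point operator and quoted processes. Processes $\Psi;\Delta\vdash P::c:C$ (which use the channels in $\Delta$ and provide $c$) are derived by exchange, forwarding, cut, the right and left rules of each type former, and spawning of quoted processes. In particular: * from $\Psi;\Delta_1\vdash P::a:A$ and $\Psi;a:A,\Delta_2\vdash Q::c:C$ derive $\Psi;\Delta_1,\Delta_2\vdash(a\leftarrow P;Q)::c:C$;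 * for closed $\rho\alpha.A$ of polarity $+$: from $\Psi;\Delta\vdash P::a:[\rho\alpha.A/\alpha]A$ derive $\Psi;\Delta\vdash(\mathsf{send}\ a\ \mathsf{unfold};P)::a:\rho\alpha.A$, and from $\Psi;\Delta,a:[\rho\alpha.A/\alpha]A\vdash Q::c:C$ derive $\Psi;\Delta,a:\rho\alpha.A\vdash(\mathsf{unfold}\leftarrow\mathsf{recv}\ a;Q)::c:C$. **Denotations.** Domains are pointed dcpos, morphisms are Scott-continuous functions; $D_\bot$ is lifting. A session type has two aspects $[\![A]\!]^-,[\![A]\!]^+$, locally continuous functors (of the two aspects of each type variable) into the category of domains and strict continuous functions: $[\![\alpha]\!]^q$ is the projection to the $q$-aspect of $\alpha$; $[\![\mathbf 1]\!]^-=\{\bot\}$, $[\![\mathbf 1]\!]^+=\{*\}_\bot$; $[\![{\downarrow}A]\!]^-=[\![A]\!]^-$, $[\![{\downarrow}A]\!]^+=[\![A]\!]^+_\bot$; $[\![\oplus\{l:A_l\}]\!]^-=\prod_l[\![A_l]\!]^-$, $[\![\oplus\{l:A_l\}]\!]^+=\bigoplus_l[\![A_l]\!]^+_\bot$ (coalesced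 sum); $[\![A\otimes B]\!]^-=[\![A]\!]^-\times[\![B]\!]^-$, $[\![A\otimes B]\!]^+=([\![A]\!]^+\times[\![B]\!]^+)_\bot$; $[\![\tau\wedge A]\!]^-=[\![A]\!]^-$, $[\![\tau\wedge A]\!]^+=([\![\tau]\!]\times[\![A]\!]^+)_\bot$; dually (with $-$ and $+$ exchanged) for $\uparrow$, $\&$, $\supset$; and $[\![A\multimap B]\!]^-=([\![A]\!]^+\times[\![B]\!]^-)_\bot$, $[\![A\multimap B]\!]^+=[\![A]\!]^-\times[\![B]\!]^+$. The pair $([\![\rho\alpha.A]\!]^-,[\![\rho\alpha.A]\!]^+)$ is the parametrized canonical fixed point (the limit of the sequence of projections that starts at the one-point domains) of the pair of functors $([\![A]\!]^-,[\![A]\!]^+)$ in the two aspects of $\alpha$. If $[\![A]\!]^p$ depends only on the $p$-aspect of $\alpha$ (for example if $\alpha$ does not occur to the left of a $\multimap$), then $[\![\rho\alpha.A]\!]^p$ is the canonical fixed point of $[\![A]\!]^p$ alone. Since $[\![[\rho\alpha.A/\alpha]A]\!]^p$ is $[\![A]\!]^p$ at the aspects of $\rho\alpha.A$, there is the canonical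 isomorphism $\mathsf{Fold}^p:[\![[\rho\alpha.A/\alpha]A]\!]^p\to[\![\rho\alpha.A]\!]^p$ with inverse $\mathsf{Unfold}^p$. Contexts denote products: $[\![\Delta]\!]^p=\prod_{a_i:A_i\in\Delta}[\![A_i]\!]^p$, $[\![\Psi]\!]=\prod_{x:\tau\in\Psi}[\![\tau]\!]$. Furthermore $[\![\tau\to\sigma]\!]$ is the domain of strict continuous functions $[\![\tau]\!]\to[\![\sigma]\!]$, $[\![\{a:A\leftarrow\Delta\}]\!]=[[\![\Delta]\!]^+\times[\![A]\!]^-\to[\![\Delta]\!]^-\times[\![A]\!]^+]_\bot$, a term $\Psi\vdash M:\tau$ denotes a continuous function $[\![\Psi]\!]\to[\![\tau]\!]$, and a process $\Psi;\Delta\vdash P::c:C$ denotes, by recursion on its derivation, a continuous function $$[\![P]\!]:[\![\Psi]\!]\to\bigl[[\![\Delta]\!]^+\times[\![C]\!]^-\to[\![\Delta]\!]^-\times[\![C]\!]^+\bigr].$$ For cut, $[\![a\leftarrow P;Q]\!]u=\mathrm{Tr}^{[\![A]\!]^-\times[\![A]\!]^+}([\![P]\!]u\times[\![Q]\!]u)$,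 where, for $f:X\times Z\to Y\times Z$, $\mathrm{Tr}^Z(f)(x)=\pi_Y f(x,z_x)$ with $z_x$ the least fixed point of $z\mapsto\pi_Zf(x,z)$. For unfold messages, $$[\![\mathsf{send}\ a\ \mathsf{unfold};P]\!]u=(\mathrm{id}\times(a^+:\mathsf{Fold}^+))\circ[\![P]\!]u\circ(\mathrm{id}\times(a^-:\mathsf{Unfold}^-)),$$ $$[\![\mathsf{unfold}\leftarrow\mathsf{recv}\ a;Q]\!]u=(\mathrm{id}\times(a^-:\mathsf{Fold}^-))\circ[\![Q]\!]u\circ(\mathrm{id}\times(a^+:\mathsf{Unfold}^+)).$$ The other constructs have their standard meaning: forwarding copies $a^+$ to $b^+$ and $b^-$ to $a^-$; sending a close message, shift, label, channel or value emits a lifted element; the corresponding receiving process pattern matches on it and is strict in it; sending a value is strict in the value; functions are call-by-value; quoting and spawning are composition with $\mathsf{up}:D\to D_\bot$ and $\mathsf{down}:D_\bot\to D$; fixed points of terms are least fixed points. Two processes of the same type are equivalent, $P\equiv Q$, if $[\![P]\!]=[\![Q]\!]$. **Proposition ($\eta$ for recursive types).** Let $\alpha^+\vdash A\ \mathsf{type}^+$,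 so that $\rho\alpha.A$ is a closed positive recursive type. If $\Psi;\Delta_1\vdash P::a:[\rho\alpha.A/\alpha]A$ and $\Psi;a:[\rho\alpha.A/\alpha]A,\Delta_2\vdash Q::c:C$, then $$a\leftarrow P;\,Q\;\equiv\;a\leftarrow(\mathsf{send}\ a\ \mathsf{unfold};P);\,(\mathsf{unfold}\leftarrow\mathsf{recv}\ a;Q).$$ -/

import Mathlib

open CategoryTheory

/-- Directed-complete partial orders: every nonempty directed subset has a least upper bound. -/
class DCPO (α : Type*) [PartialOrder α] : Prop where
  exists_isLUB : ∀ S : Set α, S.Nonempty → DirectedOn (· ≤ ·) S → ∃ x, IsLUB S x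

section Orders

variable {α β γ ξ : Type*} [PartialOrder α] [PartialOrder β] [PartialOrder γ] [PartialOrder ξ]

theorem DirectedOn.map_mono {S : Set α} (h : DirectedOn (· ≤ ·) S) {f : α → β}
    (hf : Monotone f) : DirectedOn (· ≤ ·) (f '' S) := by
  rintro _ ⟨x, hx, rfl⟩ _ ⟨y, hy, rfl⟩
  obtain ⟨z, hz, h1, h2⟩ := h x hx y hy
  exact ⟨f z, ⟨z, hz, rfl⟩, hf h1, hf h2⟩

instance : DCPO PUnit := ⟨fun _ _ _ => ⟨PUnit.unit, fun _ _ => le_rfl, fun _ _ => le_rfl⟩⟩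

instance [DCPO α] [DCPO β] : DCPO (α × β) := ⟨fun S hS hd => by
  obtain ⟨a, ha⟩ := DCPO.exists_isLUB _ (hS.image Prod.fst) (hd.map_mono monotone_fst)
  obtain ⟨b, hb⟩ := DCPO.exists_isLUB _ (hS.image Prod.snd) (hd.map_mono monotone_snd)
  exact ⟨(a, b), isLUB_prod.2 ⟨ha, hb⟩⟩⟩

instance {ι : Type*} {X : ι → Type*} [∀ i, PartialOrder (X i)] [∀ i, DCPO (X i)] :
    DCPO (∀ i, X i) := ⟨fun S hS hd => by
  choose a ha using fun i => DCPO.exists_isLUB _ (hS.image (Function.eval i))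
    (hd.map_mono (Function.monotone_eval i))
  exact ⟨a, isLUB_pi.2 ha⟩⟩

theorem sigma_directed {L : Type*} {X : L → Type*} [∀ l, PartialOrder (X l)]
    {S : Set (Σ l, X l)} (hS : S.Nonempty) (hd : DirectedOn (· ≤ ·) S) :
    ∃ (l : L) (T : Set (X l)), S = Sigma.mk l '' T ∧ T.Nonempty ∧ DirectedOn (· ≤ ·) T := by
  obtain ⟨⟨l, x⟩, hx⟩ := hS
  have key : ∀ y ∈ S, ∃ z : X l, y = ⟨l, z⟩ := by
    intro y hy
    obtain ⟨w, -, h1, h2⟩ := hd _ hx _ hy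
    obtain ⟨_, _, _, _⟩ := h1
    obtain ⟨_, _, _, _⟩ := h2
    exact ⟨_, rfl⟩
  refine ⟨l, {z | (⟨l, z⟩ : Σ l, X l) ∈ S}, ?_, ⟨x, hx⟩, ?_⟩
  · ext y
    constructor
    · intro hy
      obtain ⟨z, rfl⟩ := key y hy
      exact ⟨z, hy, rfl⟩
    · rintro ⟨z, hz, rfl⟩
      exact hz
  · intro y hy z hz
    obtain ⟨w, hw, h1, h2⟩ := hd _ hy _ hz
    obtain ⟨w, rfl⟩ := key w hw
    exact ⟨w, hw, Sigma.mk_le_mk_iff.1 h1, Sigma.mk_le_mk_iff.1 h2⟩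

theorem sigma_isLUB {L : Type*} {X : L → Type*} [∀ l, PartialOrder (X l)] {l : L}
    {T : Set (X l)} (hT : T.Nonempty) {a : X l} :
    IsLUB (Sigma.mk l '' T) (⟨l, a⟩ : Σ l, X l) ↔ IsLUB T a := by
  constructor
  · intro h
    exact ⟨fun y hy => Sigma.mk_le_mk_iff.1 (h.1 ⟨y, hy, rfl⟩), fun b hb =>
      Sigma.mk_le_mk_iff.1 (h.2 (by rintro _ ⟨y, hy, rfl⟩; exact Sigma.mk_le_mk_iff.2 (hb hy)))⟩
  · intro h
    refine ⟨by rintro _ ⟨y, hy, rfl⟩; exact Sigma.mk_le_mk_iff.2 (h.1 hy), ?_⟩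
    intro b hb
    obtain ⟨y, hy⟩ := hT
    obtain ⟨_, _, b, _⟩ := hb ⟨y, hy, rfl⟩
    exact Sigma.mk_le_mk_iff.2 (h.2 fun z hz => Sigma.mk_le_mk_iff.1 (hb ⟨z, hz, rfl⟩))

instance {L : Type*} {X : L → Type*} [∀ l, PartialOrder (X l)] [∀ l, DCPO (X l)] :
    DCPO (Σ l, X l) := ⟨fun S hS hd => by
  obtain ⟨l, T, rfl, hT, hTd⟩ := sigma_directed hS hd
  obtain ⟨a, ha⟩ := DCPO.exists_isLUB T hT hTd
  exact ⟨⟨l, a⟩, (sigma_isLUB hT).2 ha⟩⟩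

theorem withBot_directed {S : Set (WithBot α)} (hS : S.Nonempty) (hd : DirectedOn (· ≤ ·) S) :
    S = {⊥} ∨ ∃ T : Set α, T.Nonempty ∧ DirectedOn (· ≤ ·) T ∧
      ((↑) '' T : Set (WithBot α)) ⊆ S ∧ ∀ x ∈ S, x = ⊥ ∨ ∃ t ∈ T, x = ↑t := by
  have key : ∀ x ∈ S, x = ⊥ ∨ ∃ t ∈ {t : α | (t : WithBot α) ∈ S}, x = ↑t := by
    intro x hx
    induction x with
    | bot => exact Or.inl rfl
    | coe t => exact Or.inr ⟨t, hx, rfl⟩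
  by_cases h : ∃ t : α, (t : WithBot α) ∈ S
  · refine Or.inr ⟨{t | (t : WithBot α) ∈ S}, h, ?_, ?_, key⟩
    · intro y hy z hz
      obtain ⟨w, hw, h1, h2⟩ := hd _ hy _ hz
      obtain rfl | ⟨w, hw, rfl⟩ := key w hw
      · exact absurd h1 (by simp)
      · exact ⟨w, hw, WithBot.coe_le_coe.1 h1, WithBot.coe_le_coe.1 h2⟩
    · rintro _ ⟨t, ht, rfl⟩
      exact ht
  · left
    obtain ⟨x, hx⟩ := hS
    have : ∀ x ∈ S, x = ⊥ := fun x hx => (key x hx).resolve_right fun ⟨t, ht, _⟩ => h ⟨t, ht⟩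
    ext y
    exact ⟨this y, by rintro rfl; exact this x hx ▸ hx⟩

theorem withBot_isLUB {S : Set (WithBot α)} {T : Set α} (hT : T.Nonempty)
    (h1 : ((↑) '' T : Set (WithBot α)) ⊆ S) (h2 : ∀ x ∈ S, x = ⊥ ∨ ∃ t ∈ T, x = ↑t) {a : α} :
    IsLUB S (a : WithBot α) ↔ IsLUB T a := by
  constructor
  · intro h
    refine ⟨fun y hy => WithBot.coe_le_coe.1 (h.1 (h1 ⟨y, hy, rfl⟩)), fun b hb =>
      WithBot.coe_le_coe.1 (h.2 ?_)⟩
    intro x hx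
    obtain rfl | ⟨t, ht, rfl⟩ := h2 x hx
    · exact bot_le
    · exact WithBot.coe_le_coe.2 (hb ht)
  · intro h
    constructor
    · intro x hx
      obtain rfl | ⟨t, ht, rfl⟩ := h2 x hx
      · exact bot_le
      · exact WithBot.coe_le_coe.2 (h.1 ht)
    · intro b hb
      obtain ⟨t, ht⟩ := hT
      have hb' := hb (h1 ⟨t, ht, rfl⟩)
      induction b with
      | bot => exact absurd hb' (by simp)
      | coe b => exact WithBot.coe_le_coe.2 (h.2 fun z hz =>
          WithBot.coe_le_coe.1 (hb (h1 ⟨z, hz, rfl⟩)))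

/-- The lifting `α_⊥` of a dcpo. -/
instance [DCPO α] : DCPO (WithBot α) := ⟨fun S hS hd => by
  obtain rfl | ⟨T, hT, hTd, h1, h2⟩ := withBot_directed hS hd
  · exact ⟨⊥, isLUB_singleton⟩
  · obtain ⟨a, ha⟩ := DCPO.exists_isLUB T hT hTd
    exact ⟨a, (withBot_isLUB hT h1 h2).2 ha⟩⟩

/-! ### Function spaces -/

/-- Continuous (that is, Scott-continuous) functions. -/
@[ext] structure ContMap (α β : Type*) [PartialOrder α] [PartialOrder β] where
  toFun : α → β
  cont : ScottContinuous toFun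

instance : CoeFun (ContMap α β) (fun _ => α → β) := ⟨ContMap.toFun⟩

instance : PartialOrder (ContMap α β) :=
  PartialOrder.lift ContMap.toFun fun _ _ => ContMap.ext

instance [OrderBot β] : OrderBot (ContMap α β) where
  bot := ⟨fun _ => ⊥, by fun_prop⟩
  bot_le f a := bot_le (a := f a)

theorem ContMap.isLUB_of_pointwise {S : Set (ContMap α β)} {f : ContMap α β}
    (h : ∀ a, IsLUB ((fun g : ContMap α β => g a) '' S) (f a)) : IsLUB S f :=
  ⟨fun g hg a => (h a).1 ⟨g, hg, rfl⟩, fun g hg a => (h a).2 (by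
    rintro _ ⟨k, hk, rfl⟩
    exact hg hk a)⟩

theorem ContMap.exists_pointwise [DCPO β] {S : Set (ContMap α β)} (hS : S.Nonempty)
    (hd : DirectedOn (· ≤ ·) S) :
    ∃ f : ContMap α β, ∀ a, IsLUB ((fun g : ContMap α β => g a) '' S) (f a) := by
  choose f hf using fun a => DCPO.exists_isLUB ((fun g : ContMap α β => g a) '' S)
    (hS.image _) (hd.map_mono fun g k h => h a)
  refine ⟨⟨f, ?_⟩, hf⟩
  intro d hdn hdd a ha
  constructor
  · rintro _ ⟨x, hx, rfl⟩
    refine (hf x).2 ?_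
    rintro _ ⟨g, hg, rfl⟩
    exact (g.cont.monotone (ha.1 hx)).trans ((hf a).1 ⟨g, hg, rfl⟩)
  · intro b hb
    refine (hf a).2 ?_
    rintro _ ⟨g, hg, rfl⟩
    refine (g.cont hdn hdd ha).2 ?_
    rintro _ ⟨x, hx, rfl⟩
    exact ((hf x).1 ⟨g, hg, rfl⟩).trans (hb ⟨x, hx, rfl⟩)

theorem ContMap.isLUB_iff [DCPO β] {S : Set (ContMap α β)} (hS : S.Nonempty)
    (hd : DirectedOn (· ≤ ·) S) {f : ContMap α β} :
    IsLUB S f ↔ ∀ a, IsLUB ((fun g : ContMap α β => g a) '' S) (f a) := by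
  refine ⟨fun h => ?_, ContMap.isLUB_of_pointwise⟩
  obtain ⟨g, hg⟩ := ContMap.exists_pointwise hS hd
  rw [h.unique (ContMap.isLUB_of_pointwise hg)]
  exact hg

instance [DCPO β] : DCPO (ContMap α β) := ⟨fun _ hS hd =>
  let ⟨f, hf⟩ := ContMap.exists_pointwise hS hd
  ⟨f, ContMap.isLUB_of_pointwise hf⟩⟩

theorem ContMap.eval_cont [DCPO β] (a : α) : ScottContinuous fun f : ContMap α β => f a :=
  fun _ hS hd _ h => (ContMap.isLUB_iff hS hd).1 h a

@[fun_prop] theorem ContMap.apply_cont [DCPO β] {F : ξ → ContMap α β} {g : ξ → α}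
    (hF : ScottContinuous F) (hg : ScottContinuous g) : ScottContinuous fun x => F x (g x) :=
  ScottContinuous.comp (g := fun p : ContMap α β × α => p.1 p.2)
    (ScottContinuous.prodMk hF hg)
    (ScottContinuous.fromProd (fun f => f.cont) fun a => ContMap.eval_cont a)

@[fun_prop] theorem ContMap.mk_cont {f : ξ → α → β}
    (h : ScottContinuous fun p : ξ × α => f p.1 p.2) (h' : ∀ x, ScottContinuous (f x)) :
    ScottContinuous fun x => (⟨f x, h' x⟩ : ContMap α β) := by
  intro d hdn hdd a ha
  refine ContMap.isLUB_of_pointwise fun b => ?_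
  rw [← Set.image_comp]
  exact (ScottContinuous.comp (f := fun x : ξ => (x, b)) (by fun_prop) h) hdn hdd ha

/-- Currying of continuous functions. -/
def ContMap.curry (f : ξ → α → β) (h : ScottContinuous fun p : ξ × α => f p.1 p.2) :
    ContMap ξ (ContMap α β) where
  toFun x := ⟨f x, ScottContinuous.comp (f := fun a : α => (x, a)) (by fun_prop) h⟩
  cont := ContMap.mk_cont h _

/-! ### Lifting, strictness, fixed points and trace -/

@[fun_prop] theorem scottContinuous_pi {ι : Type*} {X : ι → Type*} [∀ i, PartialOrder (X i)]
    {f : ξ → ∀ i, X i} (h : ∀ i, ScottContinuous fun x => f x i) : ScottContinuous f := by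
  intro d hdn hdd a ha
  refine isLUB_pi.2 fun i => ?_
  rw [← Set.image_comp]
  exact h i hdn hdd ha

@[fun_prop] theorem scottContinuous_eval {ι : Type*} {X : ι → Type*} [∀ i, PartialOrder (X i)]
    (i : ι) : ScottContinuous fun f : ∀ i, X i => f i :=
  fun _ _ _ _ h => isLUB_pi.1 h i

/-- The unit `up` of the lifting adjunction is continuous. -/
@[fun_prop] theorem withBot_coe_cont : ScottContinuous fun a : α => (a : WithBot α) := by
  intro d hdn hdd a ha
  refine (withBot_isLUB hdn subset_rfl ?_).2 ha
  rintro _ ⟨t, ht, rfl⟩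
  exact Or.inr ⟨t, ht, rfl⟩

/-- The injection of a summand into a disjoint union is continuous. -/
@[fun_prop] theorem sigma_mk_cont {L : Type*} {X : L → Type*} [∀ l, PartialOrder (X l)] (l : L) :
    ScottContinuous fun a : X l => (⟨l, a⟩ : Σ l, X l) :=
  fun _ hdn _ _ ha => (sigma_isLUB hdn).2 ha

theorem sigma_elim_cont {L : Type*} {X : L → Type*} [∀ l, PartialOrder (X l)]
    {f : ξ → (Σ l, X l) → β} (hf : ∀ l, ScottContinuous fun p : ξ × X l => f p.1 ⟨l, p.2⟩) :
    ScottContinuous fun p : ξ × (Σ l, X l) => f p.1 p.2 := by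
  refine ScottContinuous.fromProd (fun x => ?_) fun ⟨l, b⟩ => ?_
  · intro d hdn hdd a ha
    obtain ⟨l, T, rfl, hT, hTd⟩ := sigma_directed hdn hdd
    obtain ⟨t, ht⟩ := hT
    obtain ⟨_, _, a, _⟩ := ha.1 ⟨t, ht, rfl⟩
    rw [Set.image_image]
    exact (ScottContinuous.comp (f := fun z : X l => (x, z)) (by fun_prop) (hf l)) ⟨t, ht⟩ hTd
      ((sigma_isLUB ⟨t, ht⟩).1 ha)
  · exact ScottContinuous.comp (f := fun z : ξ => (z, b)) (by fun_prop) (hf l)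

section Bot

variable [OrderBot β]

/-- The strict extension `α_⊥ → β` of a function `α → β`: it sends `⊥` to `⊥` and `↑a` to `f a`.
For `f = id` it is the counit `down`. -/
def WithBot.ext (f : α → β) : WithBot α → β := WithBot.recBotCoe ⊥ f

theorem WithBot.ext_cont {f : ξ → α → β} (hf : ScottContinuous fun p : ξ × α => f p.1 p.2)
    {l : ξ → WithBot α} (hl : ScottContinuous l) :
    ScottContinuous fun x => WithBot.ext (f x) (l x) := by
  refine ScottContinuous.comp (g := fun p : ξ × WithBot α => WithBot.ext (f p.1) p.2)
    (f := fun x => (x, l x)) (by fun_prop)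
    (ScottContinuous.fromProd (fun x => ?_) fun b => ?_)
  · have hfx : ScottContinuous (f x) :=
      ScottContinuous.comp (f := fun a : α => (x, a)) (by fun_prop) hf
    intro d hdn hdd a ha
    obtain rfl | ⟨T, hT, hTd, h1, h2⟩ := withBot_directed hdn hdd
    · obtain rfl : a = ⊥ := ha.unique isLUB_singleton
      simp
    · obtain ⟨t, ht⟩ := hT
      have hta := ha.1 (h1 ⟨t, ht, rfl⟩)
      induction a with
      | bot => exact absurd hta (by simp)
      | coe a =>
        have h := hfx ⟨t, ht⟩ hTd ((withBot_isLUB ⟨t, ht⟩ h1 h2).1 ha)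
        constructor
        · rintro _ ⟨y, hy, rfl⟩
          obtain rfl | ⟨t, ht, rfl⟩ := h2 y hy
          · exact bot_le
          · exact h.1 ⟨t, ht, rfl⟩
        · intro b hb
          refine h.2 ?_
          rintro _ ⟨t, ht, rfl⟩
          exact hb ⟨_, h1 ⟨t, ht, rfl⟩, rfl⟩
  · induction b with
    | bot => exact ScottContinuous.const _
    | coe b => exact ScottContinuous.comp (f := fun z : ξ => (z, b)) (by fun_prop) hf

/-- The strict map out of `(⨄ l, X l)_⊥` that sends `⊥` to `⊥` and `(l, ↑a)` to `f l a`. -/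
def WithBot.sumElim {L : Type*} {X : L → Type*} (f : ∀ l, X l → β) : WithBot (Σ l, X l) → β :=
  WithBot.ext fun a => f a.1 a.2

theorem WithBot.sumElim_cont {L : Type*} {X : L → Type*} [∀ l, PartialOrder (X l)]
    {f : ξ → ∀ l, X l → β} (hf : ∀ l, ScottContinuous fun p : ξ × X l => f p.1 l p.2)
    {m : ξ → WithBot (Σ l, X l)} (hm : ScottContinuous m) :
    ScottContinuous fun x => WithBot.sumElim (f x) (m x) :=
  WithBot.ext_cont (α := Σ l, X l) (f := fun x a => f x a.1 a.2)
    (sigma_elim_cont (f := fun x (a : Σ l, X l) => f x a.1 a.2) hf) hm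

open Classical in
/-- `strictIn a b` is `b` made strict in the component `a`: it is `⊥` if `a = ⊥` and `b`
otherwise. -/
noncomputable def strictIn [OrderBot α] (a : α) (b : β) : β := if a = ⊥ then ⊥ else b

@[fun_prop] theorem strictIn_cont [OrderBot α] {f : ξ → α} {g : ξ → β} (hf : ScottContinuous f)
    (hg : ScottContinuous g) : ScottContinuous fun x => strictIn (f x) (g x) := by
  classical
  refine ScottContinuous.comp (g := fun p : α × β => strictIn p.1 p.2)
    (ScottContinuous.prodMk hf hg) (ScottContinuous.fromProd (fun a => ?_) fun b => ?_)
  · by_cases ha : a = ⊥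
    · simp only [strictIn, ha, if_true]
      exact ScottContinuous.const _
    · simp only [strictIn, ha, if_false]
      exact ScottContinuous.id
  · intro d hdn hdd a ha
    by_cases h : ∃ x ∈ d, x ≠ ⊥
    · obtain ⟨x, hx, hx0⟩ := h
      have ha0 : a ≠ ⊥ := fun h => hx0 (le_bot_iff.1 (h ▸ ha.1 hx))
      constructor
      · rintro _ ⟨y, _, rfl⟩
        simp only [strictIn, ha0, if_false]
        split_ifs
        · exact bot_le
        · exact le_rfl
      · intro c hc
        have := hc ⟨x, hx, rfl⟩
        simpa only [strictIn, ha0, hx0, if_false] using this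
    · push Not at h
      have hd : d = {⊥} := by
        obtain ⟨y, hy⟩ := hdn
        ext z
        exact ⟨h z, by rintro rfl; exact h y hy ▸ hy⟩
      subst hd
      obtain rfl : a = ⊥ := ha.unique isLUB_singleton
      simp

end Bot

section Fix

variable [OrderBot α]

theorem ContMap.iterate_mono (f : ContMap α α) : Monotone fun n : ℕ => f.toFun^[n] ⊥ :=
  f.cont.monotone.monotone_iterate_of_le_map bot_le

variable [DCPO α]

theorem ContMap.exists_lfp (f : ContMap α α) :
    ∃ x, IsLUB (Set.range fun n : ℕ => f.toFun^[n] ⊥) x :=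
  DCPO.exists_isLUB _ (Set.range_nonempty _)
    (directedOn_range.2 f.iterate_mono.directed_le)

/-- The least fixed point `⨆ n, fⁿ(⊥)` of a continuous function. -/
noncomputable def ContMap.lfp (f : ContMap α α) : α := f.exists_lfp.choose

theorem ContMap.lfp_isLUB (f : ContMap α α) :
    IsLUB (Set.range fun n : ℕ => f.toFun^[n] ⊥) f.lfp := f.exists_lfp.choose_spec

theorem ContMap.lfp_le (f : ContMap α α) {x : α} (h : f x ≤ x) : f.lfp ≤ x := by
  refine f.lfp_isLUB.2 ?_
  rintro _ ⟨n, rfl⟩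
  induction n with
  | zero => exact bot_le
  | succ n ih =>
    simp only [Function.iterate_succ_apply']
    exact (f.cont.monotone ih).trans h

theorem ContMap.map_lfp (f : ContMap α α) : f f.lfp = f.lfp := by
  refine (f.cont (Set.range_nonempty _) (directedOn_range.2 f.iterate_mono.directed_le)
    f.lfp_isLUB).unique ⟨?_, fun b hb => f.lfp_isLUB.2 ?_⟩
  · rintro _ ⟨_, ⟨n, rfl⟩, rfl⟩
    refine f.lfp_isLUB.1 ⟨n + 1, ?_⟩
    simp only [Function.iterate_succ_apply']
  · rintro _ ⟨n, rfl⟩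
    refine (f.iterate_mono n.le_succ).trans (hb ⟨_, ⟨n, rfl⟩, ?_⟩)
    simp only [Function.iterate_succ_apply']

/-- The least-fixed-point operator is continuous. -/
theorem ContMap.lfp_cont : ScottContinuous (ContMap.lfp : ContMap α α → α) := by
  have mono : Monotone (ContMap.lfp : ContMap α α → α) := fun f g h =>
    f.lfp_le ((h _).trans g.map_lfp.le)
  intro S hS hd g hg
  refine ⟨mono.mem_upperBounds_image hg.1, fun b hb => ?_⟩
  obtain ⟨y, hy⟩ := DCPO.exists_isLUB _ (hS.image ContMap.lfp) (hd.map_mono mono)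
  refine le_trans (g.lfp_le ?_) (hy.2 hb)
  refine ((ContMap.isLUB_iff hS hd).1 hg y).2 ?_
  rintro _ ⟨f, hf, rfl⟩
  refine (f.cont (hS.image _) (hd.map_mono mono) hy).2 ?_
  rintro _ ⟨_, ⟨h, hh, rfl⟩, rfl⟩
  obtain ⟨k, hk, h1, h2⟩ := hd _ hf _ hh
  calc f h.lfp ≤ k k.lfp := (h1 _).trans (k.cont.monotone (mono h2))
    _ = k.lfp := k.map_lfp
    _ ≤ y := hy.1 ⟨k, hk, rfl⟩

@[fun_prop] theorem ContMap.lfp_cont' {F : ξ → ContMap α α} (h : ScottContinuous F) :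
    ScottContinuous fun x => (F x).lfp := ScottContinuous.comp h ContMap.lfp_cont

/-- The trace `Tr^X(f) = π_B ∘ f ∘ ⟨id, (π_X ∘ f)†⟩ : A → B` of `f : A × X → B × X`, where
`g†(a)` is the least fixed point of `g(a, -)`. -/
noncomputable def ContMap.trace (f : ContMap (β × α) (γ × α)) : ContMap β γ where
  toFun b := (f (b, ContMap.lfp ⟨fun x => (f (b, x)).2, by have := f.cont; fun_prop⟩)).1
  cont := by have := f.cont; fun_prop

@[fun_prop] theorem ContMap.trace_cont [DCPO γ] {F : ξ → ContMap (β × α) (γ × α)}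
    (h : ScottContinuous F) : ScottContinuous fun x => (F x).trace := by
  unfold ContMap.trace
  fun_prop

end Fix

/-! ### Strict continuous functions -/

section Strict

variable [OrderBot α] [OrderBot β]

/-- Strict continuous functions. -/
structure StrictMap (α β : Type*) [PartialOrder α] [PartialOrder β] [OrderBot α] [OrderBot β]
    extends ContMap α β where
  strict : toFun ⊥ = ⊥

instance : CoeFun (StrictMap α β) (fun _ => α → β) := ⟨fun f => f.toFun⟩

theorem StrictMap.toContMap_injective :
    Function.Injective (StrictMap.toContMap : StrictMap α β → ContMap α β) := by
  rintro ⟨f, _⟩ ⟨g, _⟩ rfl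
  rfl

@[ext] theorem StrictMap.ext {f g : StrictMap α β} (h : ∀ a, f a = g a) : f = g :=
  StrictMap.toContMap_injective (ContMap.ext (funext h))

instance : PartialOrder (StrictMap α β) :=
  PartialOrder.lift StrictMap.toContMap StrictMap.toContMap_injective

instance : OrderBot (StrictMap α β) where
  bot := ⟨⊥, rfl⟩
  bot_le f := bot_le (a := f.toContMap)

@[fun_prop] theorem StrictMap.continuous (f : StrictMap α β) : ScottContinuous f := f.toContMap.cont

theorem StrictMap.mono (f : StrictMap α β) : Monotone f := f.continuous.monotone

theorem StrictMap.isLUB_of_pointwise {S : Set (StrictMap α β)} {f : StrictMap α β}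
    (h : ∀ a, IsLUB ((fun g : StrictMap α β => g a) '' S) (f a)) : IsLUB S f :=
  ⟨fun g hg a => (h a).1 ⟨g, hg, rfl⟩, fun g hg a => (h a).2 (by
    rintro _ ⟨k, hk, rfl⟩
    exact hg hk a)⟩

theorem StrictMap.exists_pointwise [DCPO β] {S : Set (StrictMap α β)} (hS : S.Nonempty)
    (hd : DirectedOn (· ≤ ·) S) :
    ∃ f : StrictMap α β, ∀ a, IsLUB ((fun g : StrictMap α β => g a) '' S) (f a) := by
  obtain ⟨f, hf⟩ := ContMap.exists_pointwise (hS.image StrictMap.toContMap)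
    (hd.map_mono fun _ _ h => h)
  simp only [Set.image_image] at hf
  refine ⟨⟨f, le_bot_iff.1 ((hf ⊥).2 ?_)⟩, hf⟩
  rintro _ ⟨g, _, rfl⟩
  exact g.strict.le

instance [DCPO β] : DCPO (StrictMap α β) := ⟨fun _ hS hd =>
  let ⟨f, hf⟩ := StrictMap.exists_pointwise hS hd
  ⟨f, StrictMap.isLUB_of_pointwise hf⟩⟩

theorem StrictMap.eval_cont [DCPO β] (a : α) : ScottContinuous fun f : StrictMap α β => f a := by
  intro S hS hd f h
  obtain ⟨g, hg⟩ := StrictMap.exists_pointwise hS hd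
  rw [h.unique (StrictMap.isLUB_of_pointwise hg)]
  exact hg a

@[fun_prop] theorem StrictMap.apply_cont [DCPO β] {F : ξ → StrictMap α β} {g : ξ → α}
    (hF : ScottContinuous F) (hg : ScottContinuous g) : ScottContinuous fun x => F x (g x) :=
  ScottContinuous.comp (g := fun p : StrictMap α β × α => p.1 p.2)
    (ScottContinuous.prodMk hF hg)
    (ScottContinuous.fromProd (fun f => f.cont) fun a => StrictMap.eval_cont a)

theorem StrictMap.cont_of_pointwise {F : ξ → StrictMap α β}
    (h : ∀ a, ScottContinuous fun x => F x a) : ScottContinuous F := by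
  intro d hdn hdd a ha
  refine StrictMap.isLUB_of_pointwise fun b => ?_
  rw [← Set.image_comp]
  exact h b hdn hdd ha

end Strict

end Orders

namespace StrictMap

section Maps

variable {α β γ α' β' ξ : Type*} [PartialOrder α] [PartialOrder β] [PartialOrder γ]
  [PartialOrder α'] [PartialOrder β'] [PartialOrder ξ]
  [OrderBot α] [OrderBot β] [OrderBot γ] [OrderBot α'] [OrderBot β']

/-- The identity. -/
def id : StrictMap α α := ⟨⟨fun x => x, by fun_prop⟩, rfl⟩

/-- Composition, `f` then `g`. -/
def comp (f : StrictMap α β) (g : StrictMap β γ) : StrictMap α γ :=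
  ⟨⟨fun x => g (f x), by fun_prop⟩, (congrArg g f.strict).trans g.strict⟩

/-- The action of the binary product functor on morphisms. -/
def prodMap (f : StrictMap α β) (g : StrictMap α' β') : StrictMap (α × α') (β × β') :=
  ⟨⟨fun p => (f p.1, g p.2), by fun_prop⟩, Prod.ext f.strict g.strict⟩

theorem prodMap_cont [DCPO β] [DCPO β'] {F : ξ → StrictMap α β} {G : ξ → StrictMap α' β'}
    (hF : ScottContinuous F) (hG : ScottContinuous G) :
    ScottContinuous fun x => prodMap (F x) (G x) :=
  cont_of_pointwise fun p => by simp only [prodMap]; fun_prop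

/-- The action of the product functor on morphisms. -/
def piMap {ι : Type*} {X Y : ι → Type*} [∀ i, PartialOrder (X i)] [∀ i, PartialOrder (Y i)]
    [∀ i, OrderBot (X i)] [∀ i, OrderBot (Y i)] (f : ∀ i, StrictMap (X i) (Y i)) :
    StrictMap (∀ i, X i) (∀ i, Y i) :=
  ⟨⟨fun p i => f i (p i), by fun_prop⟩, funext fun i => (f i).strict⟩

theorem piMap_cont {ι : Type*} {X Y : ι → Type*} [∀ i, PartialOrder (X i)]
    [∀ i, PartialOrder (Y i)] [∀ i, OrderBot (X i)] [∀ i, OrderBot (Y i)] [∀ i, DCPO (Y i)]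
    {F : ∀ i, ξ → StrictMap (X i) (Y i)} (hF : ∀ i, ScottContinuous (F i)) :
    ScottContinuous fun x => piMap fun i => F i x :=
  cont_of_pointwise fun p => by
    simp only [piMap]
    exact scottContinuous_pi fun i => apply_cont (hF i) (ScottContinuous.const _)

/-- The action of the lifting functor on morphisms. -/
def liftMap (f : StrictMap α β) : StrictMap (WithBot α) (WithBot β) :=
  ⟨⟨WithBot.ext fun a => ↑(f a), WithBot.ext_cont (ξ := WithBot α) (by fun_prop) (by fun_prop)⟩,
    rfl⟩

theorem liftMap_cont [DCPO β] {F : ξ → StrictMap α β} (hF : ScottContinuous F) :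
    ScottContinuous fun x => liftMap (F x) :=
  cont_of_pointwise fun _ => WithBot.ext_cont (by fun_prop) (by fun_prop)

/-- The action of the sum-of-lifts functor on morphisms. -/
def liftSumMap {L : Type*} {X Y : L → Type*} [∀ i, PartialOrder (X i)] [∀ i, PartialOrder (Y i)]
    [∀ i, OrderBot (X i)] [∀ i, OrderBot (Y i)] (f : ∀ i, StrictMap (X i) (Y i)) :
    StrictMap (WithBot (Σ i, X i)) (WithBot (Σ i, Y i)) :=
  ⟨⟨WithBot.sumElim fun l a => ↑(⟨l, f l a⟩ : Σ i, Y i),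
    WithBot.sumElim_cont (f := fun _ l a => ((⟨l, f l a⟩ : Σ i, Y i) : WithBot (Σ i, Y i)))
      (fun l => ScottContinuous.comp
        (f := fun p : WithBot (Σ i, X i) × X l => (⟨l, f l p.2⟩ : Σ i, Y i))
        (by fun_prop) withBot_coe_cont) ScottContinuous.id⟩, rfl⟩

theorem liftSumMap_cont {L : Type*} {X Y : L → Type*} [∀ i, PartialOrder (X i)]
    [∀ i, PartialOrder (Y i)] [∀ i, OrderBot (X i)] [∀ i, OrderBot (Y i)] [∀ i, DCPO (Y i)]
    {F : ∀ i, ξ → StrictMap (X i) (Y i)} (hF : ∀ i, ScottContinuous (F i)) :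
    ScottContinuous fun x => liftSumMap fun i => F i x :=
  cont_of_pointwise fun b => WithBot.sumElim_cont
    (f := fun x l a => ((⟨l, F l x a⟩ : Σ i, Y i) : WithBot (Σ i, Y i)))
    (fun l => ScottContinuous.comp
      (f := fun p : ξ × X l => (⟨l, F l p.1 p.2⟩ : Σ i, Y i))
      (by have := hF l; fun_prop) withBot_coe_cont) (ScottContinuous.const b)

end Maps

end StrictMap

/-! ### The category of domains and locally continuous functors -/

/-- A domain is a pointed dcpo. -/
structure Dom : Type 1 where
  carrier : Type
  [po : PartialOrder carrier]
  [bot : OrderBot carrier]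
  [dcpo : DCPO carrier]

namespace Dom

instance : CoeSort Dom Type := ⟨Dom.carrier⟩
instance (D : Dom) : PartialOrder D := D.po
instance (D : Dom) : OrderBot D := D.bot
instance (D : Dom) : DCPO D := D.dcpo

/-- The category of domains and strict continuous functions. -/
instance : Category Dom where
  Hom D E := StrictMap D E
  id D := StrictMap.id
  comp f g := StrictMap.comp f g

/-- The one-point domain. -/
abbrev unit : Dom := ⟨PUnit⟩
/-- The binary product. -/
abbrev prod (D E : Dom) : Dom := ⟨D × E⟩
/-- Indexed products. -/
abbrev pi {ι : Type} (D : ι → Dom) : Dom := ⟨∀ i, D i⟩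
/-- The lifting `D_⊥`. -/
abbrev lift (D : Dom) : Dom := ⟨WithBot D⟩
/-- The coalesced sum of lifted domains `⨁ l, (D l)_⊥`. Its elements are `⊥` and the pairs
`(k, ↑a)` with `a ∈ D k`, so it is the lifted disjoint union of the `D l`. -/
abbrev liftSum {L : Type} (D : L → Dom) : Dom := ⟨WithBot (Σ l, D l)⟩
/-- The space of continuous functions. -/
abbrev cont (D E : Dom) : Dom := ⟨ContMap D E⟩
/-- The space of strict continuous functions. -/
abbrev strict (D E : Dom) : Dom := ⟨StrictMap D E⟩

end Dom

/-- Categories whose hom-sets are partially ordered. -/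
class HomOrder (C : Type*) [Category C] where
  order : ∀ X Y : C, PartialOrder (X ⟶ Y)

instance {C : Type*} [Category C] [HomOrder C] (X Y : C) : PartialOrder (X ⟶ Y) :=
  HomOrder.order X Y

instance : HomOrder Dom := ⟨fun D E => inferInstanceAs (PartialOrder (StrictMap D E))⟩

instance {ι : Type*} {C : Type*} [Category C] [HomOrder C] : HomOrder (ι → C) :=
  ⟨fun X Y => inferInstanceAs (PartialOrder (∀ i, X i ⟶ Y i))⟩

instance {C D : Type*} [Category C] [Category D] [HomOrder C] [HomOrder D] : HomOrder (C × D) :=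
  ⟨fun X Y => inferInstanceAs (PartialOrder ((X.1 ⟶ Y.1) × (X.2 ⟶ Y.2)))⟩

/-- Locally continuous functors: their action on hom-sets is Scott-continuous. -/
structure LCFunctor (C D : Type*) [Category C] [Category D] [HomOrder C] [HomOrder D]
    extends C ⥤ D where
  cont : ∀ X Y : C, ScottContinuous fun f : X ⟶ Y => toFunctor.map f

namespace LCFunctor

section General

variable {B C D : Type*} [Category B] [Category C] [Category D]
  [HomOrder B] [HomOrder C] [HomOrder D] {ι : Type*}

/-- Composition `F` then `G`. -/
def comp (F : LCFunctor B C) (G : LCFunctor C D) : LCFunctor B D where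
  toFunctor := F.toFunctor ⋙ G.toFunctor
  cont X Y := ScottContinuous.comp (g := fun f : F.obj X ⟶ F.obj Y => G.map f) (F.cont X Y) (G.cont _ _)

/-- The projection functors of a power. -/
def eval (i : ι) : LCFunctor (ι → C) C where
  toFunctor := Pi.eval _ i
  cont X Y := scottContinuous_eval (X := fun i => X i ⟶ Y i) i

/-- Tupling of functors. -/
def tuple (F : ι → LCFunctor B C) : LCFunctor B (ι → C) where
  toFunctor := Functor.pi' fun i => (F i).toFunctor
  cont X Y := scottContinuous_pi (X := fun i => (F i).obj X ⟶ (F i).obj Y)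
    fun i => (F i).cont X Y

/-- The functor `F × id`. -/
def prodId (F : LCFunctor B C) : LCFunctor (B × D) (C × D) where
  toFunctor := F.toFunctor.prod (𝟭 D)
  cont X Y := ScottContinuous.prod (α := X.1 ⟶ Y.1) (β := X.2 ⟶ Y.2)
    (f := fun f : X.1 ⟶ Y.1 => F.map f) (g := fun f => f) (F.cont _ _) ScottContinuous.id

/-- The first projection. -/
def fst : LCFunctor (B × C) B where
  toFunctor := CategoryTheory.Prod.fst _ _
  cont X Y := show ScottContinuous (_root_.Prod.fst : (X.1 ⟶ Y.1) × (X.2 ⟶ Y.2) → _) from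
    ScottContinuous.fst

/-- The second projection. -/
def snd : LCFunctor (B × C) C where
  toFunctor := CategoryTheory.Prod.snd _ _
  cont X Y := show ScottContinuous (_root_.Prod.snd : (X.1 ⟶ Y.1) × (X.2 ⟶ Y.2) → _) from
    ScottContinuous.snd

end General

section Formers

variable {C : Type*} [Category C] [HomOrder C]

/-- The constant functor. -/
def const (D : Dom) : LCFunctor C Dom where
  obj _ := D
  map _ := 𝟙 D
  cont _ _ := ScottContinuous.const _

/-- Binary products of functors, computed pointwise. -/
def prod (F G : LCFunctor C Dom) : LCFunctor C Dom where
  obj X := Dom.prod (F.obj X) (G.obj X)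
  map f := StrictMap.prodMap (F.map f) (G.map f)
  map_id X := by rw [F.map_id, G.map_id]; rfl
  map_comp f g := by rw [F.map_comp, G.map_comp]; rfl
  cont X Y := StrictMap.prodMap_cont (F.cont X Y) (G.cont X Y)

/-- Indexed products of functors, computed pointwise. -/
def pi {ι : Type} (F : ι → LCFunctor C Dom) : LCFunctor C Dom where
  obj X := Dom.pi fun i => (F i).obj X
  map f := StrictMap.piMap fun i => (F i).map f
  map_id X := (congrArg StrictMap.piMap (funext fun i => (F i).map_id X)).trans rfl
  map_comp f g := (congrArg StrictMap.piMap (funext fun i => (F i).map_comp f g)).trans rfl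
  cont X Y := StrictMap.piMap_cont fun i => (F i).cont X Y

/-- The functor `F_⊥`. -/
def lift (F : LCFunctor C Dom) : LCFunctor C Dom where
  obj X := Dom.lift (F.obj X)
  map f := StrictMap.liftMap (F.map f)
  map_id X := by
    rw [F.map_id]
    exact StrictMap.ext fun a => by cases a <;> rfl
  map_comp f g := by
    rw [F.map_comp]
    exact StrictMap.ext fun a => by cases a <;> rfl
  cont X Y := StrictMap.liftMap_cont (F.cont X Y)

/-- The functor `⨁ l, (F l)_⊥`. -/
def liftSum {L : Type} (F : L → LCFunctor C Dom) : LCFunctor C Dom where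
  obj X := Dom.liftSum fun l => (F l).obj X
  map f := StrictMap.liftSumMap fun l => (F l).map f
  map_id X := (congrArg StrictMap.liftSumMap (funext fun l => (F l).map_id X)).trans
    (StrictMap.ext fun a => by cases a <;> rfl)
  map_comp f g := (congrArg StrictMap.liftSumMap (funext fun l => (F l).map_comp f g)).trans
    (StrictMap.ext fun a => by cases a <;> rfl)
  cont X Y := StrictMap.liftSumMap_cont fun l => (F l).cont X Y

end Formers

end LCFunctor

/-! ### Canonical fixed points of locally continuous functors -/

section Families

variable {κ : Type}

/-- Application of a morphism of families of domains. -/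
def ap {D E : κ → Dom} (f : D ⟶ E) (k : κ) : StrictMap (D k) (E k) := f k

theorem hom_ext {D E : κ → Dom} {f g : D ⟶ E} (h : ∀ k x, ap f k x = ap g k x) : f = g :=
  funext fun k => StrictMap.ext (h k)

theorem ap_le {D E : κ → Dom} {f g : D ⟶ E} (h : f ≤ g) (k : κ) (x : D k) :
    ap f k x ≤ ap g k x := h k x

theorem ap_cont {D E : κ → Dom} (k : κ) (x : D k) :
    ScottContinuous fun f : D ⟶ E => ap f k x :=
  ScottContinuous.comp (f := fun f : D ⟶ E => ap f k)
    (scottContinuous_eval (X := fun k => D k ⟶ E k) k) (StrictMap.eval_cont x)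

theorem cont_of_ap {ξ : Type*} [PartialOrder ξ] {D E : κ → Dom} {F : ξ → (D ⟶ E)}
    (h : ∀ k x, ScottContinuous fun a => ap (F a) k x) : ScottContinuous F :=
  scottContinuous_pi (X := fun k => D k ⟶ E k) fun k => StrictMap.cont_of_pointwise (h k)

theorem precomp_cont {D E G : κ → Dom} (f : D ⟶ E) : ScottContinuous fun g : E ⟶ G => f ≫ g :=
  cont_of_ap fun k x => ap_cont k (ap f k x)

theorem postcomp_cont {D E G : κ → Dom} (g : E ⟶ G) : ScottContinuous fun f : D ⟶ E => f ≫ g :=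
  cont_of_ap fun k x => ScottContinuous.comp (ap_cont k x) (ap g k).continuous

/-- The zero morphism. -/
def zeroHom (D E : κ → Dom) : D ⟶ E := fun k => (⊥ : StrictMap (D k) (E k))

theorem zeroHom_comp {D E G : κ → Dom} (f : E ⟶ G) : zeroHom D E ≫ f = zeroHom D G :=
  hom_ext fun k _ => (ap f k).strict

theorem comp_zeroHom {D E G : κ → Dom} (f : D ⟶ E) : f ≫ zeroHom E G = zeroHom D G := rfl

theorem zeroHom_le {D E : κ → Dom} (f : D ⟶ E) : zeroHom D E ≤ f :=
  fun _ _ => bot_le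

/-- The limit of a sequence `D₀ ← D₁ ← D₂ ← ⋯`. -/
@[ext] structure Lim (D : ℕ → κ → Dom) (p : ∀ n, D (n + 1) ⟶ D n) (k : κ) : Type where
  val : ∀ n, D n k
  compat : ∀ n, ap (p n) k (val (n + 1)) = val n

variable {D : ℕ → κ → Dom} {p : ∀ n, D (n + 1) ⟶ D n}

instance (k : κ) : PartialOrder (Lim D p k) := PartialOrder.lift Lim.val fun _ _ => Lim.ext

instance (k : κ) : OrderBot (Lim D p k) where
  bot := ⟨⊥, fun n => (ap (p n) k).strict⟩
  bot_le x := bot_le (a := x.val)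

theorem lim_isLUB {k : κ} {S : Set (Lim D p k)} {a : Lim D p k}
    (h : ∀ n, IsLUB ((fun x : Lim D p k => x.val n) '' S) (a.val n)) : IsLUB S a :=
  ⟨fun x hx n => (h n).1 ⟨x, hx, rfl⟩, fun b hb n => (h n).2 (by
    rintro _ ⟨x, hx, rfl⟩
    exact hb hx n)⟩

theorem lim_exists {k : κ} {S : Set (Lim D p k)} (hS : S.Nonempty)
    (hd : DirectedOn (· ≤ ·) S) :
    ∃ a : Lim D p k, ∀ n, IsLUB ((fun x : Lim D p k => x.val n) '' S) (a.val n) := by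
  have hm : ∀ n, DirectedOn (· ≤ ·) ((fun x : Lim D p k => x.val n) '' S) :=
    fun n => hd.map_mono fun x y h => h n
  choose b hb using fun n => DCPO.exists_isLUB _ (hS.image fun x : Lim D p k => x.val n) (hm n)
  refine ⟨⟨b, fun n => ?_⟩, hb⟩
  have h := (ap (p n) k).continuous (hS.image _) (hm (n + 1)) (hb (n + 1))
  rw [Set.image_image] at h
  simp only [Lim.compat] at h
  exact h.unique (hb n)

instance (k : κ) : DCPO (Lim D p k) := ⟨fun _ hS hd =>
  let ⟨a, ha⟩ := lim_exists hS hd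
  ⟨a, lim_isLUB ha⟩⟩

/-- The limit as a family of domains. -/
abbrev limDom (D : ℕ → κ → Dom) (p : ∀ n, D (n + 1) ⟶ D n) (k : κ) : Dom := ⟨Lim D p k⟩

theorem lim_cont {ξ : Type*} [PartialOrder ξ] {k : κ} {f : ξ → Lim D p k}
    (h : ∀ n, ScottContinuous fun x => (f x).val n) : ScottContinuous f := by
  intro d hdn hdd a ha
  refine lim_isLUB fun n => ?_
  rw [Set.image_image]
  exact h n hdn hdd ha

theorem lim_val_cont (k : κ) (n : ℕ) : ScottContinuous fun x : Lim D p k => x.val n := by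
  intro S hS hd a ha
  obtain ⟨b, hb⟩ := lim_exists hS hd
  rw [ha.unique (lim_isLUB hb)]
  exact hb n

/-- A pair of morphisms as a morphism of a product category. -/
abbrev homPair {C D : Type*} [Category C] [Category D] {X Y : C} {Z W : D} (f : X ⟶ Y)
    (g : Z ⟶ W) : (X, Z) ⟶ (Y, W) := (f, g)

end Families

namespace LCFunctor

/-- The functor given by the limits of a natural sequence of projections. -/
def lim {C : Type*} [Category C] [HomOrder C] {κ : Type} (D : C → ℕ → κ → Dom)
    (p : ∀ X n, D X (n + 1) ⟶ D X n) (m : ∀ {X Y : C}, (X ⟶ Y) → ∀ n, D X n ⟶ D Y n)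
    (nat : ∀ {X Y : C} (f : X ⟶ Y) n, p X n ≫ m f n = m f (n + 1) ≫ p Y n)
    (hid : ∀ X n, m (𝟙 X) n = 𝟙 _)
    (hcomp : ∀ {X Y Z : C} (f : X ⟶ Y) (g : Y ⟶ Z) n, m (f ≫ g) n = m f n ≫ m g n)
    (hcont : ∀ X Y n, ScottContinuous fun f : X ⟶ Y => m f n) : LCFunctor C (κ → Dom) where
  obj X := limDom (D X) (p X)
  map {X Y} f := fun k => (⟨⟨fun x => ⟨fun n => ap (m f n) k (x.val n), fun n =>
      (congrArg (fun h => ap h k (x.val (n + 1))) (nat f n)).symm.trans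
        (congrArg (ap (m f n) k) (x.compat n))⟩,
    lim_cont fun n => ScottContinuous.comp (lim_val_cont k n) (ap (m f n) k).continuous⟩,
    Lim.ext (funext fun n => (ap (m f n) k).strict)⟩ :
      StrictMap (Lim (D X) (p X) k) (Lim (D Y) (p Y) k))
  map_id X := hom_ext (D := limDom (D X) (p X)) (E := limDom (D X) (p X))
    fun k (x : Lim (D X) (p X) k) => Lim.ext (funext fun n =>
    congrArg (fun h => ap h k (x.val n)) (hid X n))
  map_comp {X _ Z} f g := hom_ext (D := limDom (D X) (p X)) (E := limDom (D Z) (p Z))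
    fun k (x : Lim (D X) (p X) k) => Lim.ext (funext fun n =>
      congrArg (fun h => ap h k (x.val n)) (hcomp f g n))
  cont X Y := cont_of_ap fun k (x : Lim (D X) (p X) k) => lim_cont fun n =>
    ScottContinuous.comp (hcont X Y n) (ap_cont k (x.val n))

section Dagger

variable {B C : Type*} [Category B] [HomOrder B] [Category C] [HomOrder C] {κ : Type}
  (F : LCFunctor (C × (κ → Dom)) (κ → Dom))

/-- The functor `F` applied to the identity of `X` and to `f`. -/
def mapSnd (X : C) {D E : κ → Dom} (f : D ⟶ E) : F.obj (X, D) ⟶ F.obj (X, E) :=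
  F.map (homPair (𝟙 X) f)

theorem mapSnd_id (X : C) (D : κ → Dom) : F.mapSnd X (𝟙 D) = 𝟙 _ := F.map_id (X, D)

theorem mapSnd_comp (X : C) {D E G : κ → Dom} (f : D ⟶ E) (g : E ⟶ G) :
    F.mapSnd X (f ≫ g) = F.mapSnd X f ≫ F.mapSnd X g := by
  unfold mapSnd
  rw [← F.map_comp]
  congr 1
  exact Prod.ext (Category.comp_id _).symm rfl

theorem mapSnd_cont (X : C) (D E : κ → Dom) :
    ScottContinuous fun f : D ⟶ E => F.mapSnd X f :=
  ScottContinuous.comp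
    (f := fun f : D ⟶ E => (homPair (𝟙 X) f))
    (ScottContinuous.prodMk (α := D ⟶ E) (β := X ⟶ X) (γ := D ⟶ E) (ScottContinuous.const _)
      ScottContinuous.id) (F.cont (X, D) (X, E))

/-- The approximations `D₀ = 1`, `Dₙ₊₁ = F(X, Dₙ)` of the canonical fixed point of `F(X, -)`. -/
def chain (X : C) (n : ℕ) : κ → Dom :=
  Nat.rec (fun _ => Dom.unit) (fun _ D => F.obj (X, D)) n

/-- The canonical morphism `Dₙ ⟶ Dₘ`: a composite of embeddings if `n ≤ m`, of projections if
`m ≤ n`. -/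
def link (X : C) : ∀ n m : ℕ, F.chain X n ⟶ F.chain X m
  | 0, _ => zeroHom _ _
  | _ + 1, 0 => zeroHom _ _
  | n + 1, m + 1 => F.mapSnd X (link X n m)

/-- The action of the approximations on morphisms of the parameter. -/
def chainMap {X Y : C} (f : X ⟶ Y) : ∀ n, F.chain X n ⟶ F.chain Y n
  | 0 => 𝟙 _
  | n + 1 => F.map (homPair f (chainMap f n))

theorem link_zero_right (X : C) (n : ℕ) : F.link X n 0 = zeroHom _ _ := by
  cases n <;> rfl

theorem link_self (X : C) (n : ℕ) : F.link X n n = 𝟙 _ := by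
  induction n with
  | zero => exact hom_ext fun k _ => rfl
  | succ n ih => exact (congrArg (F.mapSnd X) ih).trans (F.mapSnd_id X _)

theorem link_comp (X : C) : ∀ n m k : ℕ, min n k ≤ m →
    F.link X n m ≫ F.link X m k = F.link X n k
  | 0, m, k, _ => zeroHom_comp _
  | n + 1, m, 0, _ => by rw [link_zero_right, link_zero_right, comp_zeroHom]
  | n + 1, 0, k + 1, h => by omega
  | n + 1, m + 1, k + 1, h => (F.mapSnd_comp X _ _).symm.trans
      (congrArg (F.mapSnd X) (link_comp X n m k (by omega)))

theorem link_comp_le (X : C) : ∀ n m k : ℕ, F.link X n m ≫ F.link X m k ≤ F.link X n k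
  | 0, m, k => (zeroHom_comp (F.link X m k)).trans_le (zeroHom_le _)
  | n + 1, m, 0 => by rw [link_zero_right, comp_zeroHom]; exact zeroHom_le _
  | n + 1, 0, k + 1 => by rw [link_zero_right, zeroHom_comp]; exact zeroHom_le _
  | n + 1, m + 1, k + 1 => le_of_eq_of_le (F.mapSnd_comp X _ _).symm
      ((F.mapSnd_cont X _ _).monotone (link_comp_le X n m k))

theorem link_nat {X Y : C} (f : X ⟶ Y) : ∀ n m,
    F.link X n m ≫ F.chainMap f m = F.chainMap f n ≫ F.link Y n m
  | 0, m => (zeroHom_comp _).trans (Category.id_comp _).symm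
  | n + 1, 0 => rfl
  | n + 1, m + 1 => by
    refine (F.map_comp _ _).symm.trans (Eq.trans (congrArg F.map ?_) (F.map_comp _ _))
    exact Prod.ext ((Category.id_comp f).trans (Category.comp_id f).symm) (link_nat f n m)

theorem chainMap_id (X : C) : ∀ n, F.chainMap (𝟙 X) n = 𝟙 _
  | 0 => rfl
  | n + 1 => (congrArg (fun h => F.map (homPair (𝟙 X) h)) (chainMap_id X n)).trans
      (F.map_id (X, F.chain X n))

theorem chainMap_comp {X Y Z : C} (f : X ⟶ Y) (g : Y ⟶ Z) : ∀ n,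
    F.chainMap (f ≫ g) n = F.chainMap f n ≫ F.chainMap g n
  | 0 => rfl
  | n + 1 => (congrArg (fun h => F.map (homPair (f ≫ g) h)) (chainMap_comp f g n)).trans
      (F.map_comp (homPair f (F.chainMap f n)) (homPair g (F.chainMap g n)))

theorem chainMap_cont (X Y : C) : ∀ n, ScottContinuous fun f : X ⟶ Y => F.chainMap f n
  | 0 => ScottContinuous.const _
  | n + 1 => ScottContinuous.comp
      (f := fun f : X ⟶ Y => (homPair f (F.chainMap f n)))
      (ScottContinuous.prodMk (α := X ⟶ Y) (β := X ⟶ Y) (γ := F.chain X n ⟶ F.chain Y n)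
        ScottContinuous.id (chainMap_cont X Y n)) (F.cont _ _)

/-- The parametrized canonical fixed point `F†` of a locally continuous functor `F`. -/
def dagger : LCFunctor C (κ → Dom) :=
  lim F.chain (fun X n => F.link X (n + 1) n) F.chainMap (fun f n => F.link_nat f (n + 1) n)
    F.chainMap_id F.chainMap_comp F.chainMap_cont

theorem lim_congr {D : C → ℕ → κ → Dom} {p q : ∀ X n, D X (n + 1) ⟶ D X n}
    {m m' : ∀ {X Y : C}, (X ⟶ Y) → ∀ n, D X n ⟶ D Y n} {h1 h1' h2 h2' h3 h3' h4 h4'} (h : p = q)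
    (h' : ∀ {X Y : C} (f : X ⟶ Y) n, m f n = m' f n) :
    lim D p m h1 h2 h3 h4 = lim D q m' h1' h2' h3' h4' := by
  obtain rfl : @m = @m' := funext fun X => funext fun Y => funext fun f => funext (h' f)
  subst h
  rfl

theorem link_prodId (S : LCFunctor B C) (X : B) : ∀ n m,
    (S.prodId.comp F).link X n m = F.link (S.obj X) n m
  | 0, _ => rfl
  | _ + 1, 0 => rfl
  | n + 1, m + 1 => (congrArg ((S.prodId.comp F).mapSnd X) (link_prodId S X n m)).trans
      (congrArg (fun h => F.map (homPair h (F.link (S.obj X) n m))) (S.map_id X))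

theorem chainMap_prodId (S : LCFunctor B C) {X Y : B} (f : X ⟶ Y) : ∀ n,
    (S.prodId.comp F).chainMap f n = F.chainMap (S.map f) n
  | 0 => rfl
  | n + 1 => congrArg (fun h => F.map (homPair (S.map f) h)) (chainMap_prodId S f n)

/-- Canonical fixed points are natural in the parameter. -/
theorem dagger_comp (S : LCFunctor B C) : (S.prodId.comp F).dagger = S.comp F.dagger :=
  lim_congr (D := fun X => F.chain (S.obj X))
    (h1' := fun f n => F.link_nat (S.map f) (n + 1) n)
    (h2' := fun X n => (congrArg (F.chainMap · n) (S.map_id X)).trans (F.chainMap_id _ n))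
    (h3' := fun f g n => (congrArg (F.chainMap · n) (S.map_comp f g)).trans
      (F.chainMap_comp _ _ n))
    (h4' := fun X Y n => ScottContinuous.comp (S.cont X Y) (F.chainMap_cont _ _ n))
    (funext fun X => funext fun n => F.link_prodId S X (n + 1) n) (F.chainMap_prodId S)

/-- The fixed point of `F(X, -)` at `k`. -/
abbrev Fix (X : C) (k : κ) : Type := Lim (F.chain X) (fun n => F.link X (n + 1) n) k

theorem Fix.link {F : LCFunctor (C × (κ → Dom)) (κ → Dom)} {X : C} {k : κ} (x : F.Fix X k)
    (n d : ℕ) : ap (F.link X (n + d) n) k (x.val (n + d)) = x.val n := by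
  induction d with
  | zero => exact congrArg (fun h => ap h k (x.val n)) (F.link_self X n)
  | succ d ih =>
    refine Eq.trans ?_ ((congrArg (ap (F.link X (n + d) n) k) (x.compat (n + d))).trans ih)
    exact (congrArg (fun h => ap h k (x.val (n + d + 1)))
      (F.link_comp X (n + d + 1) (n + d) n (by omega))).symm

theorem Fix.link_le {F : LCFunctor (C × (κ → Dom)) (κ → Dom)} {X : C} {k : κ} (x : F.Fix X k)
    (n m : ℕ) : ap (F.link X n m) k (x.val n) ≤ x.val m := by
  obtain h | h := le_total n m
  · obtain ⟨d, rfl⟩ := Nat.exists_eq_add_of_le h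
    rw [← x.link n d]
    exact (ap_le (F.link_comp_le X (n + d) n (n + d)) k (x.val (n + d))).trans
      (congrArg (fun h => ap h k (x.val (n + d))) (F.link_self X (n + d))).le
  · obtain ⟨d, rfl⟩ := Nat.exists_eq_add_of_le h
    exact (x.link m d).le

/-- The projection of the fixed point to an approximation. -/
def proj (X : C) (n : ℕ) : F.dagger.obj X ⟶ F.chain X n := fun k =>
  (⟨⟨fun x => x.val n, lim_val_cont k n⟩, rfl⟩ : StrictMap (F.Fix X k) (F.chain X n k))

/-- The morphism to the fixed point given by compatible morphisms to the approximations. -/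
def toFix (X : C) {E : κ → Dom} (f : ∀ n, E ⟶ F.chain X n)
    (h : ∀ n, f (n + 1) ≫ F.link X (n + 1) n = f n) : E ⟶ F.dagger.obj X := fun k =>
  (⟨⟨fun y => ⟨fun n => ap (f n) k y, fun n => congrArg (fun g => ap g k y) (h n)⟩,
    lim_cont fun n => (ap (f n) k).continuous⟩,
    Lim.ext (funext fun n => (ap (f n) k).strict)⟩ : StrictMap (E k) (F.Fix X k))

/-- The embedding of an approximation into the fixed point. -/
def inj (X : C) (n : ℕ) : F.chain X n ⟶ F.dagger.obj X :=
  F.toFix X (F.link X n) fun m => F.link_comp X n (m + 1) m (by omega)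

/-- The morphism `Fold : F(X, F†X) ⟶ F†X`. -/
def fold (X : C) : F.obj (X, F.dagger.obj X) ⟶ F.dagger.obj X :=
  F.toFix X (fun n => match n with
    | 0 => zeroHom _ _
    | n + 1 => F.mapSnd X (F.proj X n)) fun n => match n with
    | 0 => rfl
    | n + 1 => (F.mapSnd_comp X _ _).symm.trans (congrArg (F.mapSnd X)
        (hom_ext fun _ (x : F.Fix X _) => x.compat n))

theorem fix_hom_ext {X : C} {E : κ → Dom} {f g : E ⟶ F.dagger.obj X}
    (h : ∀ n, f ≫ F.proj X n = g ≫ F.proj X n) : f = g :=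
  hom_ext fun k y => Lim.ext (funext fun n => congrArg (fun f => ap f k y) (h n))

theorem proj_inj_isLUB (X : C) :
    IsLUB (Set.range fun n => F.proj X (n + 1) ≫ F.inj X (n + 1)) (𝟙 (F.dagger.obj X)) := by
  constructor
  · rintro _ ⟨n, rfl⟩ k (x : F.Fix X k) m
    exact x.link_le (n + 1) m
  · intro g hg k (x : F.Fix X k) n
    refine le_trans ?_ (hg ⟨n, rfl⟩ k x n)
    exact (x.link n 1).symm.trans_le le_rfl

theorem proj_inj_isLUB' (X : C) :
    IsLUB (Set.range fun n => F.proj X n ≫ F.inj X n) (𝟙 (F.dagger.obj X)) := by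
  constructor
  · rintro _ ⟨n, rfl⟩ k (x : F.Fix X k) m
    exact x.link_le n m
  · intro g hg
    refine (F.proj_inj_isLUB X).2 ?_
    rintro _ ⟨n, rfl⟩
    exact hg ⟨n + 1, rfl⟩

/-- The approximations of `Unfold`. -/
def unfoldApprox (X : C) (n : ℕ) : F.dagger.obj X ⟶ F.obj (X, F.dagger.obj X) :=
  F.proj X (n + 1) ≫ F.mapSnd X (F.inj X n)

theorem unfoldApprox_mono (X : C) : Monotone (F.unfoldApprox X) := by
  refine monotone_nat_of_le_succ fun n => ?_
  have h1 : F.mapSnd X (F.inj X n) = F.link X (n + 1) (n + 2) ≫ F.mapSnd X (F.inj X (n + 1)) :=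
    (congrArg (F.mapSnd X) (F.fix_hom_ext fun m =>
      (F.link_comp X n (n + 1) m (by omega)).symm)).trans (F.mapSnd_comp X _ _)
  intro k (x : F.Fix X k)
  exact (congrArg (fun h => ap h k (x.val (n + 1))) h1).trans_le
    ((ap (F.mapSnd X (F.inj X (n + 1))) k).mono (x.link_le (n + 1) (n + 2)))

theorem exists_unfold (X : C) : ∃ u, IsLUB (Set.range (F.unfoldApprox X)) u := by
  let h : ∃ u : ∀ k, StrictMap (F.Fix X k) (F.obj (X, F.dagger.obj X) k),
      IsLUB (Set.range (F.unfoldApprox X)) u := DCPO.exists_isLUB _ (Set.range_nonempty _)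
    (directedOn_range.2 (F.unfoldApprox_mono X).directed_le)
  exact h

/-- The morphism `Unfold : F†X ⟶ F(X, F†X)`. -/
noncomputable def unfold (X : C) : F.dagger.obj X ⟶ F.obj (X, F.dagger.obj X) :=
  (F.exists_unfold X).choose

theorem unfold_isLUB (X : C) : IsLUB (Set.range (F.unfoldApprox X)) (F.unfold X) :=
  (F.exists_unfold X).choose_spec

/-- The isomorphism `Fold : F(X, F†X) ≅ F†X : Unfold`. -/
noncomputable def foldIso (X : C) : F.obj (X, F.dagger.obj X) ≅ F.dagger.obj X where
  hom := F.fold X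
  inv := F.unfold X
  hom_inv_id := by
    have hd := directedOn_range.2 (F.unfoldApprox_mono X).directed_le
    have h := precomp_cont (F.fold X) (Set.range_nonempty _) hd (F.unfold_isLUB X)
    have hm : Monotone fun n => F.proj X n ≫ F.inj X n := fun n m hnm k (x : F.Fix X k) j => by
      obtain ⟨d, rfl⟩ := Nat.exists_eq_add_of_le hnm
      have h := (ap (F.link X n j) k).mono (x.link n d).ge
      exact h.trans (ap_le (F.link_comp_le X (n + d) n j) k (x.val (n + d)))
    have h' := F.mapSnd_cont X _ _ (Set.range_nonempty _) (directedOn_range.2 hm.directed_le)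
      (F.proj_inj_isLUB' X)
    rw [← Set.range_comp] at h h'
    refine h.unique (Eq.mp ?_ h')
    refine congrArg₂ IsLUB (congrArg Set.range ?_) (F.mapSnd_id X _)
    exact funext fun n => F.mapSnd_comp X (F.proj X n) (F.inj X n)
  inv_hom_id := by
    have hd := directedOn_range.2 (F.unfoldApprox_mono X).directed_le
    have h := postcomp_cont (F.fold X) (Set.range_nonempty _) hd (F.unfold_isLUB X)
    rw [← Set.range_comp] at h
    refine h.unique ?_
    convert F.proj_inj_isLUB X using 2
    funext n
    refine (Category.assoc _ _ _).trans (congrArg (F.proj X (n + 1) ≫ ·) ?_)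
    refine F.fix_hom_ext fun m => ?_
    cases m with
    | zero => rfl
    | succ m => exact (F.mapSnd_comp X _ _).symm

end Dagger

end LCFunctor

/-! ### Types -/

/-- Polarities; they also name the two aspects of a type. -/
inductive Pol
  | neg
  | pos

/-- `Var Ξ p` is the set of variables of polarity `p` in the type context `Ξ` (de Bruijn indices). -/
inductive Var : List Pol → Pol → Type
  | zero {Ξ : List Pol} {p : Pol} : Var (p :: Ξ) p
  | succ {Ξ : List Pol} {p q : Pol} (v : Var Ξ q) : Var (p :: Ξ) q

mutual

/-- Session types: `STy Ξ p` is the set of derivations of `Ξ ⊢ A type^p`. Labels are natural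
numbers. In order: `1`, `α`, `ρα.A`, `↓A`, `↑A`, `⊕{l : A l}`, `&{l : A l}`, `A ⊗ B`, `A ⊸ B`,
`τ ∧ A`, `τ ⊃ A`. -/
inductive STy : List Pol → Pol → Type
  | one {Ξ : List Pol} : STy Ξ .pos
  | var {Ξ : List Pol} {p : Pol} (v : Var Ξ p) : STy Ξ p
  | recur {Ξ : List Pol} {p : Pol} (A : STy (p :: Ξ) p) : STy Ξ p
  | down {Ξ : List Pol} (A : STy Ξ .neg) : STy Ξ .pos
  | up {Ξ : List Pol} (A : STy Ξ .pos) : STy Ξ .neg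
  | plus {Ξ : List Pol} (L : Finset ℕ) (A : L → STy Ξ .pos) : STy Ξ .pos
  | amp {Ξ : List Pol} (L : Finset ℕ) (A : L → STy Ξ .neg) : STy Ξ .neg
  | tensor {Ξ : List Pol} (A B : STy Ξ .pos) : STy Ξ .pos
  | lolly {Ξ : List Pol} (A : STy Ξ .pos) (B : STy Ξ .neg) : STy Ξ .neg
  | and {Ξ : List Pol} (τ : FType) (A : STy Ξ .pos) : STy Ξ .pos
  | imp {Ξ : List Pol} (τ : FType) (A : STy Ξ .neg) : STy Ξ .neg

/-- Functional types: `proc Δ A` is the type `{a : A ← a₁ : Δ₁, …, aₙ : Δₙ}` of quoted processes,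
`arrow τ σ` is the type of functions. -/
inductive FType : Type
  | proc {n : ℕ} {ps : Fin n → Pol} (Δ : ∀ i, STy [] (ps i)) {p : Pol} (A : STy [] p) : FType
  | arrow (τ σ : FType) : FType

end

/-- A renaming under a binder. -/
def Var.lift {Ξ Ξ' : List Pol} {r : Pol} (f : ∀ p, Var Ξ p → Var Ξ' p) :
    ∀ p, Var (r :: Ξ) p → Var (r :: Ξ') p
  | _, .zero => .zero
  | _, .succ v => .succ (f _ v)

/-- Renaming of type variables. -/
def STy.rename : ∀ {Ξ Ξ' : List Pol} {p : Pol}, (∀ p, Var Ξ p → Var Ξ' p) → STy Ξ p → STy Ξ' p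
  | _, _, _, _, .one => .one
  | _, _, _, f, .var v => .var (f _ v)
  | _, _, _, f, .recur A => .recur (A.rename (Var.lift f))
  | _, _, _, f, .down A => .down (A.rename f)
  | _, _, _, f, .up A => .up (A.rename f)
  | _, _, _, f, .plus L A => .plus L fun l => (A l).rename f
  | _, _, _, f, .amp L A => .amp L fun l => (A l).rename f
  | _, _, _, f, .tensor A B => .tensor (A.rename f) (B.rename f)
  | _, _, _, f, .lolly A B => .lolly (A.rename f) (B.rename f)
  | _, _, _, f, .and τ A => .and τ (A.rename f)
  | _, _, _, f, .imp τ A => .imp τ (A.rename f)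

/-- A substitution under a binder. -/
def STy.lift {Ξ Ξ' : List Pol} {r : Pol} (f : ∀ p, Var Ξ p → STy Ξ' p) :
    ∀ p, Var (r :: Ξ) p → STy (r :: Ξ') p
  | _, .zero => .var .zero
  | _, .succ v => (f _ v).rename fun _ => .succ

/-- Capture-avoiding simultaneous substitution of types for type variables. -/
def STy.subst : ∀ {Ξ Ξ' : List Pol} {p : Pol}, (∀ p, Var Ξ p → STy Ξ' p) → STy Ξ p → STy Ξ' p
  | _, _, _, _, .one => .one
  | _, _, _, f, .var v => f _ v
  | _, _, _, f, .recur A => .recur (A.subst (STy.lift f))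
  | _, _, _, f, .down A => .down (A.subst f)
  | _, _, _, f, .up A => .up (A.subst f)
  | _, _, _, f, .plus L A => .plus L fun l => (A l).subst f
  | _, _, _, f, .amp L A => .amp L fun l => (A l).subst f
  | _, _, _, f, .tensor A B => .tensor (A.subst f) (B.subst f)
  | _, _, _, f, .lolly A B => .lolly (A.subst f) (B.subst f)
  | _, _, _, f, .and τ A => .and τ (A.subst f)
  | _, _, _, f, .imp τ A => .imp τ (A.subst f)

/-- The substitution of `ρα.A` for `α`. -/
def STy.unfoldSubst {p : Pol} (A : STy [p] p) : ∀ q, Var [p] q → STy [] q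
  | _, .zero => .recur A

/-- The unfolding `[ρα.A/α]A` of `ρα.A`. -/
def STy.unfold {p : Pol} (A : STy [p] p) : STy [] p := A.subst A.unfoldSubst

/-! ### Denotations of types -/

/-- The semantic type context: every type variable stands for two domains, its aspects. -/
abbrev Idx (Ξ : List Pol) : Type := (Σ p, Var Ξ p) × Pol

/-- The empty semantic type context. -/
def noVars : Idx [] → Dom := fun i => nomatch i.1.2

/-- The extension of a semantic type context by the two aspects of a new variable. -/
def consVar (Ξ : List Pol) (p : Pol) :
    LCFunctor ((Idx Ξ → Dom) × (Pol → Dom)) (Idx (p :: Ξ) → Dom) :=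
  .tuple fun i => match i with
    | (⟨_, .zero⟩, s) => LCFunctor.snd.comp (.eval s)
    | (⟨_, .succ v⟩, s) => LCFunctor.fst.comp (.eval (⟨_, v⟩, s))

mutual

/-- The aspects `⟦Ξ ⊢ A⟧⁻` and `⟦Ξ ⊢ A⟧⁺` of a session type, as locally continuous functors.
A variable stands for its two aspects, because `⊸` exchanges the aspects of its first argument; so
the two aspects of `ρα.A` are the canonical fixed point of the pair of functors
`(⟦A⟧⁻, ⟦A⟧⁺)`. If `⟦A⟧⁻` and `⟦A⟧⁺` depend only on the negative and only on the positive aspect of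
`α`, in this order, then its approximations, and hence its aspects, are computed separately, and
`⟦ρα.A⟧ˢ` is the canonical fixed point of `⟦A⟧ˢ`. -/
def STy.den : ∀ {Ξ : List Pol} {p : Pol}, STy Ξ p → Pol → LCFunctor (Idx Ξ → Dom) Dom
  | _, _, .one, .neg => .const .unit
  | _, _, .one, .pos => .const (.lift .unit)
  | _, _, .var v, s => .eval (⟨_, v⟩, s)
  | Ξ, p, .recur A, s =>
    (LCFunctor.dagger (.tuple fun s' => (consVar Ξ p).comp (A.den s'))).comp (.eval s)
  | _, _, .down A, .neg => A.den .neg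
  | _, _, .down A, .pos => .lift (A.den .pos)
  | _, _, .up A, .neg => .lift (A.den .neg)
  | _, _, .up A, .pos => A.den .pos
  | _, _, .plus _ A, .neg => .pi fun l => (A l).den .neg
  | _, _, .plus _ A, .pos => .liftSum fun l => (A l).den .pos
  | _, _, .amp _ A, .neg => .liftSum fun l => (A l).den .neg
  | _, _, .amp _ A, .pos => .pi fun l => (A l).den .pos
  | _, _, .tensor A B, .neg => .prod (A.den .neg) (B.den .neg)
  | _, _, .tensor A B, .pos => .lift (.prod (A.den .pos) (B.den .pos))
  | _, _, .lolly A B, .neg => .lift (.prod (A.den .pos) (B.den .neg))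
  | _, _, .lolly A B, .pos => .prod (A.den .neg) (B.den .pos)
  | _, _, .and _ A, .neg => A.den .neg
  | _, _, .and τ A, .pos => .lift (.prod (.const τ.den) (A.den .pos))
  | _, _, .imp τ A, .neg => .lift (.prod (.const τ.den) (A.den .neg))
  | _, _, .imp _ A, .pos => A.den .pos

/-- The domains denoted by functional types. -/
def FType.den : FType → Dom
  | .proc Δ A => .lift (.cont
      (.prod (.pi fun i => ((Δ i).den .pos).obj noVars) ((A.den .neg).obj noVars))
      (.prod (.pi fun i => ((Δ i).den .neg).obj noVars) ((A.den .pos).obj noVars)))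
  | .arrow τ σ => .strict τ.den σ.den

end

theorem LCFunctor.tuple_ext {B C : Type*} [Category B] [Category C] [HomOrder B] [HomOrder C]
    {ι : Type*} {F G : LCFunctor B (ι → C)} (h : ∀ i, F.comp (.eval i) = G.comp (.eval i)) :
    F = G :=
  show LCFunctor.tuple (fun i => F.comp (.eval i)) = LCFunctor.tuple (fun i => G.comp (.eval i))
  from congrArg LCFunctor.tuple (funext h)

/-- The interpretation of a renaming. -/
def renFun {Ξ Ξ' : List Pol} (f : ∀ p, Var Ξ p → Var Ξ' p) :
    LCFunctor (Idx Ξ' → Dom) (Idx Ξ → Dom) :=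
  .tuple fun i => .eval (⟨_, f _ i.1.2⟩, i.2)

/-- The interpretation of a substitution. -/
def subFun {Ξ Ξ' : List Pol} (f : ∀ p, Var Ξ p → STy Ξ' p) :
    LCFunctor (Idx Ξ' → Dom) (Idx Ξ → Dom) :=
  .tuple fun i => (f _ i.1.2).den i.2

theorem den_recur_congr {Ξ Ξ' : List Pol} {p : Pol} (A : STy (p :: Ξ) p) (A' : STy (p :: Ξ') p)
    (S : LCFunctor (Idx Ξ' → Dom) (Idx Ξ → Dom))
    (S' : LCFunctor (Idx (p :: Ξ') → Dom) (Idx (p :: Ξ) → Dom))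
    (h : ∀ s, A'.den s = S'.comp (A.den s))
    (hS : (consVar Ξ' p).comp S' = S.prodId.comp (consVar Ξ p)) (s : Pol) :
    (STy.recur A').den s = S.comp ((STy.recur A).den s) := by
  have h1 : (fun s => (consVar Ξ' p).comp (A'.den s)) =
      fun s => (S.prodId.comp (consVar Ξ p)).comp (A.den s) := funext fun s => by
    rw [h s, ← hS]
    rfl
  have h2 := LCFunctor.dagger_comp (.tuple fun s => (consVar Ξ p).comp (A.den s)) S
  calc (STy.recur A').den s
      = (LCFunctor.dagger (.tuple fun s => (consVar Ξ' p).comp (A'.den s))).comp (.eval s) := by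
        rw [STy.den]
    _ = (S.comp (LCFunctor.dagger (.tuple fun s => (consVar Ξ p).comp (A.den s)))).comp
          (.eval s) := by rw [h1, ← h2]; rfl
    _ = S.comp ((STy.recur A).den s) := by rw [STy.den]; rfl

theorem consVar_ren {Ξ Ξ' : List Pol} {p : Pol} (f : ∀ p, Var Ξ p → Var Ξ' p) :
    (consVar Ξ' p).comp (renFun (Var.lift f)) = (renFun f).prodId.comp (consVar Ξ p) := by
  refine LCFunctor.tuple_ext ?_
  rintro ⟨⟨q, v⟩, s⟩
  cases v <;> rfl

theorem STy.den_rename : ∀ {Ξ Ξ' : List Pol} {p : Pol} (f : ∀ p, Var Ξ p → Var Ξ' p)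
    (A : STy Ξ p) (s : Pol), (A.rename f).den s = (renFun f).comp (A.den s)
  | _, _, _, _, .one, .neg => rfl
  | _, _, _, _, .one, .pos => rfl
  | _, _, _, _, .var _, _ => rfl
  | _, _, _, f, .recur A, s => den_recur_congr A _ _ _ (A.den_rename _) (consVar_ren f) s
  | _, _, _, f, .down A, .neg => A.den_rename f .neg
  | _, _, _, f, .down A, .pos => congrArg LCFunctor.lift (A.den_rename f .pos)
  | _, _, _, f, .up A, .neg => congrArg LCFunctor.lift (A.den_rename f .neg)
  | _, _, _, f, .up A, .pos => A.den_rename f .pos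
  | _, _, _, f, .plus _ A, .neg => congrArg LCFunctor.pi (funext fun l => (A l).den_rename f .neg)
  | _, _, _, f, .plus _ A, .pos =>
    congrArg LCFunctor.liftSum (funext fun l => (A l).den_rename f .pos)
  | _, _, _, f, .amp _ A, .neg =>
    congrArg LCFunctor.liftSum (funext fun l => (A l).den_rename f .neg)
  | _, _, _, f, .amp _ A, .pos => congrArg LCFunctor.pi (funext fun l => (A l).den_rename f .pos)
  | _, _, _, f, .tensor A B, .neg =>
    congrArg₂ LCFunctor.prod (A.den_rename f .neg) (B.den_rename f .neg)
  | _, _, _, f, .tensor A B, .pos => congrArg LCFunctor.lift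
      (congrArg₂ LCFunctor.prod (A.den_rename f .pos) (B.den_rename f .pos))
  | _, _, _, f, .lolly A B, .neg => congrArg LCFunctor.lift
      (congrArg₂ LCFunctor.prod (A.den_rename f .pos) (B.den_rename f .neg))
  | _, _, _, f, .lolly A B, .pos =>
    congrArg₂ LCFunctor.prod (A.den_rename f .neg) (B.den_rename f .pos)
  | _, _, _, f, .and _ A, .neg => A.den_rename f .neg
  | _, _, _, f, .and τ A, .pos =>
    congrArg (fun F => LCFunctor.lift (.prod (.const τ.den) F)) (A.den_rename f .pos)
  | _, _, _, f, .imp τ A, .neg =>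
    congrArg (fun F => LCFunctor.lift (.prod (.const τ.den) F)) (A.den_rename f .neg)
  | _, _, _, f, .imp _ A, .pos => A.den_rename f .pos

theorem consVar_sub {Ξ Ξ' : List Pol} {p : Pol} (f : ∀ p, Var Ξ p → STy Ξ' p) :
    (consVar Ξ' p).comp (subFun (STy.lift f)) = (subFun f).prodId.comp (consVar Ξ p) := by
  refine LCFunctor.tuple_ext ?_
  rintro ⟨⟨q, v⟩, s⟩
  cases v with
  | zero => rfl
  | succ v => exact congrArg ((consVar Ξ' p).comp ·) ((f q v).den_rename (fun _ => .succ) s)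

/-- Syntactic substitution is semantic composition. -/
theorem STy.den_subst : ∀ {Ξ Ξ' : List Pol} {p : Pol} (f : ∀ p, Var Ξ p → STy Ξ' p)
    (A : STy Ξ p) (s : Pol), (A.subst f).den s = (subFun f).comp (A.den s)
  | _, _, _, _, .one, .neg => rfl
  | _, _, _, _, .one, .pos => rfl
  | _, _, _, _, .var _, _ => rfl
  | _, _, _, f, .recur A, s => den_recur_congr A _ _ _ (A.den_subst _) (consVar_sub f) s
  | _, _, _, f, .down A, .neg => A.den_subst f .neg
  | _, _, _, f, .down A, .pos => congrArg LCFunctor.lift (A.den_subst f .pos)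
  | _, _, _, f, .up A, .neg => congrArg LCFunctor.lift (A.den_subst f .neg)
  | _, _, _, f, .up A, .pos => A.den_subst f .pos
  | _, _, _, f, .plus _ A, .neg => congrArg LCFunctor.pi (funext fun l => (A l).den_subst f .neg)
  | _, _, _, f, .plus _ A, .pos =>
    congrArg LCFunctor.liftSum (funext fun l => (A l).den_subst f .pos)
  | _, _, _, f, .amp _ A, .neg =>
    congrArg LCFunctor.liftSum (funext fun l => (A l).den_subst f .neg)
  | _, _, _, f, .amp _ A, .pos => congrArg LCFunctor.pi (funext fun l => (A l).den_subst f .pos)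
  | _, _, _, f, .tensor A B, .neg =>
    congrArg₂ LCFunctor.prod (A.den_subst f .neg) (B.den_subst f .neg)
  | _, _, _, f, .tensor A B, .pos => congrArg LCFunctor.lift
      (congrArg₂ LCFunctor.prod (A.den_subst f .pos) (B.den_subst f .pos))
  | _, _, _, f, .lolly A B, .neg => congrArg LCFunctor.lift
      (congrArg₂ LCFunctor.prod (A.den_subst f .pos) (B.den_subst f .neg))
  | _, _, _, f, .lolly A B, .pos =>
    congrArg₂ LCFunctor.prod (A.den_subst f .neg) (B.den_subst f .pos)
  | _, _, _, f, .and _ A, .neg => A.den_subst f .neg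
  | _, _, _, f, .and τ A, .pos =>
    congrArg (fun F => LCFunctor.lift (.prod (.const τ.den) F)) (A.den_subst f .pos)
  | _, _, _, f, .imp τ A, .neg =>
    congrArg (fun F => LCFunctor.lift (.prod (.const τ.den) F)) (A.den_subst f .neg)
  | _, _, _, f, .imp _ A, .pos => A.den_subst f .pos

/-- A session type of some polarity. -/
abbrev Ty : Type := Σ p, STy [] p

/-- The aspects of a closed session type. -/
def Ty.den (A : Ty) (s : Pol) : Dom := (A.2.den s).obj noVars

/-- The functors of which `ρα.A` is the canonical fixed point. -/
def STy.recFun {p : Pol} (A : STy [p] p) :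
    LCFunctor ((Idx [] → Dom) × (Pol → Dom)) (Pol → Dom) :=
  .tuple fun s => (consVar [] p).comp (A.den s)

/-- The aspects of `[ρα.A/α]A` are those of `A` at the aspects of `ρα.A`. -/
theorem STy.den_unfold {p : Pol} (A : STy [p] p) (s : Pol) :
    Ty.den ⟨p, A.unfold⟩ s = A.recFun.obj (noVars, A.recFun.dagger.obj noVars) s := by
  have h : (subFun A.unfoldSubst).obj noVars =
      (consVar [] p).obj (noVars, A.recFun.dagger.obj noVars) := by
    funext ⟨⟨q, v⟩, s⟩
    cases v with
    | zero => rfl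
    | succ v => exact nomatch v
  exact (congrArg (fun F : LCFunctor _ _ => F.obj noVars) (A.den_subst A.unfoldSubst s)).trans
    (congrArg (A.den s).obj h)

/-- The isomorphism `Fold : ⟦[ρα.A/α]A⟧ ≅ ⟦ρα.A⟧ : Unfold` in aspect `s`. -/
noncomputable def STy.foldIso {p : Pol} (A : STy [p] p) (s : Pol) :
    Ty.den ⟨p, A.unfold⟩ s ≅ Ty.den ⟨p, .recur A⟩ s :=
  eqToIso (A.den_unfold s) ≪≫ Pi.isoApp (A.recFun.foldIso noVars) s

/-- The morphism `Fold` in aspect `s`. -/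
noncomputable def STy.fold {p : Pol} (A : STy [p] p) (s : Pol) :
    StrictMap (Ty.den ⟨p, A.unfold⟩ s) (Ty.den ⟨p, .recur A⟩ s) := (A.foldIso s).hom

/-- The morphism `Unfold` in aspect `s`. -/
noncomputable def STy.unfoldMap {p : Pol} (A : STy [p] p) (s : Pol) :
    StrictMap (Ty.den ⟨p, .recur A⟩ s) (Ty.den ⟨p, A.unfold⟩ s) := (A.foldIso s).inv

/-! ### Terms and processes -/

/-- Extension of a context by one entry. -/
def ext {X J : Type} (a : X) (f : J → X) : Option J → X
  | none => a
  | some j => f j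

mutual

/-- `Tm Ψ τ` is the set of derivations of `Ψ ⊢ M : τ`. The constructor `quote` takes a process
`Ψ ; a₁ : Δ₁, …, aₙ : Δₙ ⊢ P :: a : A` to a value of type `{a : A ← a₁ : Δ₁, …, aₙ : Δₙ}`. -/
inductive Tm : ∀ {K : Type}, (K → FType) → FType → Type 1
  | var {K : Type} {Ψ : K → FType} (x : K) : Tm Ψ (Ψ x)
  | fix {K : Type} {Ψ : K → FType} {τ : FType} (M : Tm (ext τ Ψ) τ) : Tm Ψ τ
  | lam {K : Type} {Ψ : K → FType} {τ σ : FType} (M : Tm (ext τ Ψ) σ) : Tm Ψ (.arrow τ σ)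
  | app {K : Type} {Ψ : K → FType} {τ σ : FType} (M : Tm Ψ (.arrow τ σ)) (N : Tm Ψ τ) : Tm Ψ σ
  | quote {K : Type} {Ψ : K → FType} {n : ℕ} {ps : Fin n → Pol} {Δ : ∀ i, STy [] (ps i)} {p : Pol}
      {A : STy [] p} (P : Proc Ψ (fun i => (⟨ps i, Δ i⟩ : Ty)) ⟨p, A⟩) : Tm Ψ (.proc Δ A)

/-- `Proc Ψ Δ A` is the set of derivations of `Ψ ; Δ ⊢ P :: a : A`. Contexts are families indexed
by arbitrary sets of names; `ext A Δ` is `Δ, a : A` (and `a : A, Δ`), `Sum.elim Δ₁ Δ₂` is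
`Δ₁, Δ₂`, and `exch` is exchange, that is, the renaming and reordering of the used channels.
The other constructors are the forwarding rule, the cut rule `a ← P; Q`, a right rule (`R`: the
process provides `a`) and a left rule (`L`: the process uses `a`) for each type former, and the
rule `unquote` that spawns a quoted process. -/
inductive Proc : ∀ {K J : Type}, (K → FType) → (J → Ty) → Ty → Type 1
  | exch {K J J' : Type} {Ψ : K → FType} {Δ : J → Ty} {C : Ty} (e : J' ≃ J) (P : Proc Ψ Δ C) :
      Proc Ψ (fun j => Δ (e j)) C
  | fwd {K : Type} {Ψ : K → FType} {A : Ty} : Proc Ψ (fun _ : Unit => A) A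
  | cut {K J₁ J₂ : Type} {Ψ : K → FType} {Δ₁ : J₁ → Ty} {Δ₂ : J₂ → Ty} {A C : Ty}
      (P : Proc Ψ Δ₁ A) (Q : Proc Ψ (ext A Δ₂) C) : Proc Ψ (Sum.elim Δ₁ Δ₂) C
  | oneR {K : Type} {Ψ : K → FType} : Proc Ψ (Empty.elim : Empty → Ty) ⟨_, .one⟩
  | oneL {K J : Type} {Ψ : K → FType} {Δ : J → Ty} {C : Ty} (P : Proc Ψ Δ C) :
      Proc Ψ (ext ⟨_, .one⟩ Δ) C
  | downR {K J : Type} {Ψ : K → FType} {Δ : J → Ty} {A : STy [] .neg} (P : Proc Ψ Δ ⟨_, A⟩) :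
      Proc Ψ Δ ⟨_, .down A⟩
  | downL {K J : Type} {Ψ : K → FType} {Δ : J → Ty} {C : Ty} {A : STy [] .neg}
      (P : Proc Ψ (ext ⟨_, A⟩ Δ) C) : Proc Ψ (ext ⟨_, .down A⟩ Δ) C
  | upR {K J : Type} {Ψ : K → FType} {Δ : J → Ty} {A : STy [] .pos} (P : Proc Ψ Δ ⟨_, A⟩) :
      Proc Ψ Δ ⟨_, .up A⟩
  | upL {K J : Type} {Ψ : K → FType} {Δ : J → Ty} {C : Ty} {A : STy [] .pos}
      (P : Proc Ψ (ext ⟨_, A⟩ Δ) C) : Proc Ψ (ext ⟨_, .up A⟩ Δ) C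
  | plusR {K J : Type} {Ψ : K → FType} {Δ : J → Ty} {L : Finset ℕ} {A : L → STy [] .pos} (k : L)
      (P : Proc Ψ Δ ⟨_, A k⟩) : Proc Ψ Δ ⟨_, .plus L A⟩
  | plusL {K J : Type} {Ψ : K → FType} {Δ : J → Ty} {C : Ty} {L : Finset ℕ}
      {A : L → STy [] .pos} (P : ∀ l, Proc Ψ (ext ⟨_, A l⟩ Δ) C) :
      Proc Ψ (ext ⟨_, .plus L A⟩ Δ) C
  | ampR {K J : Type} {Ψ : K → FType} {Δ : J → Ty} {L : Finset ℕ} {A : L → STy [] .neg}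
      (P : ∀ l, Proc Ψ Δ ⟨_, A l⟩) : Proc Ψ Δ ⟨_, .amp L A⟩
  | ampL {K J : Type} {Ψ : K → FType} {Δ : J → Ty} {C : Ty} {L : Finset ℕ} {A : L → STy [] .neg}
      (k : L) (P : Proc Ψ (ext ⟨_, A k⟩ Δ) C) : Proc Ψ (ext ⟨_, .amp L A⟩ Δ) C
  | tensorR {K J : Type} {Ψ : K → FType} {Δ : J → Ty} {A B : STy [] .pos} (P : Proc Ψ Δ ⟨_, A⟩) :
      Proc Ψ (ext ⟨_, B⟩ Δ) ⟨_, .tensor B A⟩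
  | tensorL {K J : Type} {Ψ : K → FType} {Δ : J → Ty} {C : Ty} {A B : STy [] .pos}
      (P : Proc Ψ (ext ⟨_, B⟩ (ext ⟨_, A⟩ Δ)) C) : Proc Ψ (ext ⟨_, .tensor B A⟩ Δ) C
  | lollyR {K J : Type} {Ψ : K → FType} {Δ : J → Ty} {B : STy [] .pos} {A : STy [] .neg}
      (P : Proc Ψ (ext ⟨_, B⟩ Δ) ⟨_, A⟩) : Proc Ψ Δ ⟨_, .lolly B A⟩
  | lollyL {K J : Type} {Ψ : K → FType} {Δ : J → Ty} {C : Ty} {B : STy [] .pos} {A : STy [] .neg}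
      (P : Proc Ψ (ext ⟨_, A⟩ Δ) C) : Proc Ψ (ext ⟨_, .lolly B A⟩ (ext ⟨_, B⟩ Δ)) C
  | andR {K J : Type} {Ψ : K → FType} {Δ : J → Ty} {τ : FType} {A : STy [] .pos} (M : Tm Ψ τ)
      (P : Proc Ψ Δ ⟨_, A⟩) : Proc Ψ Δ ⟨_, .and τ A⟩
  | andL {K J : Type} {Ψ : K → FType} {Δ : J → Ty} {C : Ty} {τ : FType} {A : STy [] .pos}
      (P : Proc (ext τ Ψ) (ext ⟨_, A⟩ Δ) C) : Proc Ψ (ext ⟨_, .and τ A⟩ Δ) C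
  | impR {K J : Type} {Ψ : K → FType} {Δ : J → Ty} {τ : FType} {A : STy [] .neg}
      (P : Proc (ext τ Ψ) Δ ⟨_, A⟩) : Proc Ψ Δ ⟨_, .imp τ A⟩
  | impL {K J : Type} {Ψ : K → FType} {Δ : J → Ty} {C : Ty} {τ : FType} {A : STy [] .neg}
      (M : Tm Ψ τ) (P : Proc Ψ (ext ⟨_, A⟩ Δ) C) : Proc Ψ (ext ⟨_, .imp τ A⟩ Δ) C
  /-- `send a unfold; P` for positive `ρα.A` -/
  | recPosR {K J : Type} {Ψ : K → FType} {Δ : J → Ty} {A : STy [.pos] .pos}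
      (P : Proc Ψ Δ ⟨_, A.unfold⟩) : Proc Ψ Δ ⟨_, .recur A⟩
  /-- `unfold ← recv a; P` for positive `ρα.A` -/
  | recPosL {K J : Type} {Ψ : K → FType} {Δ : J → Ty} {C : Ty} {A : STy [.pos] .pos}
      (P : Proc Ψ (ext ⟨_, A.unfold⟩ Δ) C) : Proc Ψ (ext ⟨_, .recur A⟩ Δ) C
  /-- `unfold ← recv a; P` for negative `ρα.A` -/
  | recNegR {K J : Type} {Ψ : K → FType} {Δ : J → Ty} {A : STy [.neg] .neg}
      (P : Proc Ψ Δ ⟨_, A.unfold⟩) : Proc Ψ Δ ⟨_, .recur A⟩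
  /-- `send a unfold; P` for negative `ρα.A` -/
  | recNegL {K J : Type} {Ψ : K → FType} {Δ : J → Ty} {C : Ty} {A : STy [.neg] .neg}
      (P : Proc Ψ (ext ⟨_, A.unfold⟩ Δ) C) : Proc Ψ (ext ⟨_, .recur A⟩ Δ) C
  | unquote {K : Type} {Ψ : K → FType} {n : ℕ} {ps : Fin n → Pol} {Δ : ∀ i, STy [] (ps i)}
      {p : Pol} {A : STy [] p} (M : Tm Ψ (.proc Δ A)) :
      Proc Ψ (fun i => (⟨ps i, Δ i⟩ : Ty)) ⟨p, A⟩

end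

/-! ### Denotations of terms and processes -/

/-- The domain of environments of a functional context. -/
abbrev envDom {K : Type} (Ψ : K → FType) : Dom := .pi fun k => (Ψ k).den

/-- The product of the aspects of the channels in a context. -/
abbrev chanDom {J : Type} (Δ : J → Ty) (s : Pol) : Dom := .pi fun j => (Δ j).den s

/-- The environment `[u | x ↦ v]`. -/
def consEnv {K : Type} {Ψ : K → FType} {τ : FType} (v : τ.den) (u : envDom Ψ) :
    envDom (ext τ Ψ)
  | none => v
  | some k => u k

/-- A communication on the channels of `Δ, a : A`. -/
def consChan {J : Type} {Δ : J → Ty} {A : Ty} {s : Pol} (a : A.den s) (d : chanDom Δ s) :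
    chanDom (ext A Δ) s
  | none => a
  | some j => d j

/-- A communication on the channels of `Δ₁, Δ₂`. -/
def sumChan {J₁ J₂ : Type} {Δ₁ : J₁ → Ty} {Δ₂ : J₂ → Ty} {s : Pol} (d₁ : chanDom Δ₁ s)
    (d₂ : chanDom Δ₂ s) : chanDom (Sum.elim Δ₁ Δ₂) s
  | .inl j => d₁ j
  | .inr j => d₂ j

section Operations

variable {ξ : Type*} [PartialOrder ξ]

@[fun_prop] theorem consEnv_cont {K : Type} {Ψ : K → FType} {τ : FType} {f : ξ → τ.den}
    {g : ξ → envDom Ψ} (hf : ScottContinuous f) (hg : ScottContinuous g) :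
    ScottContinuous fun x => consEnv (f x) (g x) := by
  refine scottContinuous_pi fun k => ?_
  cases k with
  | none => exact hf
  | some k => exact ScottContinuous.comp hg (scottContinuous_eval k)

@[fun_prop] theorem consChan_cont {J : Type} {Δ : J → Ty} {A : Ty} {s : Pol} {f : ξ → A.den s}
    {g : ξ → chanDom Δ s} (hf : ScottContinuous f) (hg : ScottContinuous g) :
    ScottContinuous fun x => consChan (f x) (g x) := by
  refine scottContinuous_pi fun k => ?_
  cases k with
  | none => exact hf
  | some k => exact ScottContinuous.comp hg (scottContinuous_eval k)

@[fun_prop] theorem sumChan_cont {J₁ J₂ : Type} {Δ₁ : J₁ → Ty} {Δ₂ : J₂ → Ty} {s : Pol}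
    {f : ξ → chanDom Δ₁ s} {g : ξ → chanDom Δ₂ s} (hf : ScottContinuous f)
    (hg : ScottContinuous g) : ScottContinuous fun x => sumChan (f x) (g x) := by
  refine scottContinuous_pi fun k => ?_
  cases k with
  | inl k => exact ScottContinuous.comp hf (scottContinuous_eval k)
  | inr k => exact ScottContinuous.comp hg (scottContinuous_eval k)

variable {K J J' J₁ J₂ : Type} {Ψ : K → FType} {Δ : J → Ty} {Δ₁ : J₁ → Ty} {Δ₂ : J₂ → Ty}
  {τ σ : FType} {A C : Ty}
  {U Ap An Bp Bn Dp Dn Cp Cn : Dom}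

/-- Denotations of terms: `[⟦Ψ⟧ → ⟦τ⟧]`. -/
abbrev TmDen (Ψ : K → FType) (τ : FType) : Type := ContMap (envDom Ψ) τ.den

/-- `[⟦Δ⟧⁺ × ⟦a : A⟧⁻ → ⟦Δ⟧⁻ × ⟦a : A⟧⁺]`. -/
abbrev procDom (Δ : J → Ty) (A : Ty) : Dom :=
  .cont (.prod (chanDom Δ .pos) (A.den .neg)) (.prod (chanDom Δ .neg) (A.den .pos))

/-- Denotations of processes: `[⟦Ψ⟧ → ⟦Δ ⊢ a : A⟧]`. -/
abbrev ProcDen (Ψ : K → FType) (Δ : J → Ty) (A : Ty) : Type :=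
  ContMap (envDom Ψ) (procDom Δ A)

/-- Denotations of processes that provide a channel with aspects `An`, `Ap` and use channels with
aspects `Dn`, `Dp`. -/
abbrev RDen (U Dn Dp An Ap : Dom) : Type := ContMap U (ContMap (Dp × An) (Dn × Ap))

/-- Denotations of processes that use one more channel, with aspects `An`, `Ap`. -/
abbrev LDen (U An Ap Dn Dp Cn Cp : Dom) : Type :=
  ContMap U (ContMap (Ap × Dp × Cn) (An × Dn × Cp))

namespace Sem

/-- Isolation of the last channel of a context. -/
def split (p : ProcDen Ψ (ext A Δ) C) :
    LDen (envDom Ψ) (A.den .neg) (A.den .pos) (chanDom Δ .neg) (chanDom Δ .pos) (C.den .neg)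
      (C.den .pos) :=
  .curry (fun u x =>
    let y := p u (consChan x.1 x.2.1, x.2.2)
    (y.1 none, fun j => y.1 (some j), y.2)) (by have := p.cont; fun_prop)

/-- The inverse of `split`. -/
def join (p : LDen (envDom Ψ) (A.den .neg) (A.den .pos) (chanDom Δ .neg) (chanDom Δ .pos)
      (C.den .neg) (C.den .pos)) : ProcDen Ψ (ext A Δ) C :=
  .curry (fun u x =>
    let y := p u (x.1 none, fun j => x.1 (some j), x.2)
    (consChan y.1 y.2.1, y.2.2)) (by have := p.cont; fun_prop)

/-- `F-Fun` -/
noncomputable def lam (M : TmDen (ext τ Ψ) σ) : TmDen Ψ (.arrow τ σ) :=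
  ⟨fun u => (⟨⟨fun v => strictIn v (M (consEnv v u)), by have := M.cont; fun_prop⟩,
      if_pos rfl⟩ : StrictMap τ.den σ.den),
    StrictMap.cont_of_pointwise fun v => by have := M.cont; fun_prop⟩

/-- `F-App` -/
def app (M : TmDen Ψ (.arrow τ σ)) (N : TmDen Ψ τ) : TmDen Ψ σ :=
  ⟨fun u => (show StrictMap τ.den σ.den from M u).toFun (N u),
    StrictMap.apply_cont (α := τ.den) (β := σ.den) M.cont N.cont⟩

/-- `F-Fix` -/
noncomputable def fix (M : TmDen (ext τ Ψ) τ) : TmDen Ψ τ :=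
  ⟨fun u => ContMap.lfp ⟨fun v => M (consEnv v u), by have := M.cont; fun_prop⟩,
    by have := M.cont; fun_prop⟩

/-- Composition with `up` -/
def quote (p : ContMap U Ap) : ContMap U (Dom.lift Ap) :=
  ⟨fun u => ((p u : Ap) : WithBot Ap), by have := p.cont; fun_prop⟩

/-- Composition with `down` -/
def unquote (p : ContMap U (Dom.lift Ap)) : ContMap U Ap :=
  ⟨fun u => WithBot.ext (fun a => a) (p u), WithBot.ext_cont (by fun_prop) p.cont⟩

/-- Exchange -/
def exch (e : J' ≃ J) (p : ProcDen Ψ Δ C) : ProcDen Ψ (fun j => Δ (e j)) C :=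
  .curry (fun u x =>
    let y := p u ((Equiv.piCongrLeft (fun j => ((Δ j).den .pos : Type)) e x.1 :
      chanDom Δ .pos), x.2)
    (fun j => y.1 (e j), y.2)) (by
      have h : ScottContinuous fun d : chanDom (fun j => Δ (e j)) .pos =>
          (Equiv.piCongrLeft (fun j => ((Δ j).den .pos : Type)) e d : chanDom Δ .pos) := by
        refine scottContinuous_pi fun j => ?_
        obtain ⟨j, rfl⟩ := e.surjective j
        simp only [Equiv.piCongrLeft_apply_apply]
        exact scottContinuous_eval j
      have := p.cont
      fun_prop)

/-- Forwarding -/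
def fwd : ProcDen Ψ (fun _ : Unit => A) A :=
  .curry (fun _ x => (fun _ => x.2, x.1 ())) (by fun_prop)

/-- Cut: the trace of `p × q` over `a⁻ × a⁺` -/
noncomputable def cut (p : ProcDen Ψ Δ₁ A) (q : ProcDen Ψ (ext A Δ₂) C) :
    ProcDen Ψ (Sum.elim Δ₁ Δ₂) C where
  toFun u := ContMap.trace (α := A.den .neg × A.den .pos)
    ⟨fun x =>
      let y := p u (fun j => x.1.1 (Sum.inl j), x.2.1)
      let z := split q u (x.2.2, fun j => x.1.1 (Sum.inr j), x.1.2)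
      ((sumChan y.1 z.2.1, z.2.2), (z.1, y.2)), by
        have := p.cont
        have := (split q).cont
        fun_prop⟩
  cont := by
    have := p.cont
    have := (split q).cont
    fun_prop

/-- `1 R` -/
def oneR : RDen U Dn Dp .unit (.lift .unit) :=
  .curry (fun _ _ => (⊥, ((PUnit.unit : PUnit) : WithBot PUnit))) (by fun_prop)

/-- `1 L` -/
noncomputable def oneL (p : RDen U Dn Dp Cn Cp) : LDen U .unit (.lift .unit) Dn Dp Cn Cp :=
  .curry (fun u x => strictIn x.1
    (let y := p u x.2
     (PUnit.unit, y.1, y.2))) (by have := p.cont; fun_prop)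

/-- `↓ R` -/
def downR (p : RDen U Dn Dp An Ap) : RDen U Dn Dp An (.lift Ap) :=
  .curry (fun u x => ((p u x).1, ((p u x).2 : WithBot Ap))) (by have := p.cont; fun_prop)

/-- `↓ L`; here and below, `WithBot.ext` is pattern matching, made strict. -/
def downL (p : LDen U An Ap Dn Dp Cn Cp) : LDen U An (.lift Ap) Dn Dp Cn Cp :=
  .curry (fun u x => WithBot.ext (fun a => p u (a, x.2)) x.1)
    (by have := p.cont; exact WithBot.ext_cont (by fun_prop) (by fun_prop))

/-- `↑ R` -/
def upR (p : RDen U Dn Dp An Ap) : RDen U Dn Dp (.lift An) Ap :=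
  .curry (fun u x => WithBot.ext (fun a => p u (x.1, a)) x.2)
    (by have := p.cont; exact WithBot.ext_cont (by fun_prop) (by fun_prop))

/-- `↑ L` -/
def upL (p : LDen U An Ap Dn Dp Cn Cp) : LDen U (.lift An) Ap Dn Dp Cn Cp :=
  .curry (fun u x => (((p u x).1 : WithBot An), (p u x).2)) (by have := p.cont; fun_prop)

section Choice

variable {L : Finset ℕ} {Aps Ans : L → Dom}

/-- The tuple with `a` in component `l` and `⊥` elsewhere -/
def single {X : L → Dom} (l : L) (a : X l) : Dom.pi X := Function.update (fun _ => ⊥) l a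

@[fun_prop] theorem single_cont {X : L → Dom} (l : L) {f : ξ → X l} (hf : ScottContinuous f) :
    ScottContinuous fun x => single (X := X) l (f x) := by
  refine scottContinuous_pi fun k => ?_
  by_cases h : k = l
  · subst h
    simpa only [single, Function.update_self] using hf
  · simp [single, h]

/-- The tagged communication `(k, ↑a)` -/
def tag {X : L → Dom} (k : L) (a : X k) : Dom.liftSum X :=
  ((⟨k, a⟩ : Σ l, X l) : WithBot (Σ l, X l))

@[fun_prop] theorem tag_cont {X : L → Dom} (k : L) {f : ξ → X k} (hf : ScottContinuous f) :
    ScottContinuous fun x => tag (X := X) k (f x) :=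
  ScottContinuous.comp (ScottContinuous.comp hf (sigma_mk_cont (X := fun l => (X l : Type)) k))
    withBot_coe_cont

/-- `⊕ R` with label `k` -/
def plusR (k : L) (p : RDen U Dn Dp (Ans k) (Aps k)) :
    RDen U Dn Dp (.pi Ans) (.liftSum Aps) :=
  .curry (fun u x =>
    let y := p u (x.1, x.2 k)
    (y.1, tag k y.2)) (by have := p.cont; fun_prop)

/-- `⊕ L` -/
def plusL (p : ∀ l, LDen U (Ans l) (Aps l) Dn Dp Cn Cp) :
    LDen U (.pi Ans) (.liftSum Aps) Dn Dp Cn Cp :=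
  .curry (fun u x => WithBot.sumElim (fun l a =>
      let y := p l u (a, x.2)
      (single l y.1, y.2)) x.1)
    (WithBot.sumElim_cont (fun l => by have := (p l).cont; fun_prop) (by fun_prop))

/-- `& R` -/
def ampR (p : ∀ l, RDen U Dn Dp (Ans l) (Aps l)) :
    RDen U Dn Dp (.liftSum Ans) (.pi Aps) :=
  .curry (fun u x => WithBot.sumElim (fun l a =>
      let y := p l u (x.1, a)
      (y.1, single l y.2)) x.2)
    (WithBot.sumElim_cont (fun l => by have := (p l).cont; fun_prop) (by fun_prop))

/-- `& L` with label `k` -/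
def ampL (k : L) (p : LDen U (Ans k) (Aps k) Dn Dp Cn Cp) :
    LDen U (.liftSum Ans) (.pi Aps) Dn Dp Cn Cp :=
  .curry (fun u x =>
    let y := p u (x.1 k, x.2)
    (tag k y.1, y.2)) (by have := p.cont; fun_prop)

end Choice

/-- `⊗ R` -/
def tensorR (p : RDen U Dn Dp An Ap) :
    LDen U Bn Bp Dn Dp (.prod Bn An) (.lift (.prod Bp Ap)) :=
  .curry (fun u x =>
    let y := p u (x.2.1, x.2.2.2)
    (x.2.2.1, y.1, (((x.1, y.2) : Bp × Ap) : WithBot (Bp × Ap)))) (by have := p.cont; fun_prop)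

/-- `⊗ L` -/
def tensorL {B : Ty} (p : ProcDen Ψ (ext B (ext A Δ)) C) :
    LDen (envDom Ψ) (.prod (B.den .neg) (A.den .neg)) (.lift (.prod (B.den .pos) (A.den .pos)))
      (chanDom Δ .neg) (chanDom Δ .pos) (C.den .neg) (C.den .pos) :=
  .curry (fun u x => WithBot.ext (fun v : B.den .pos × A.den .pos =>
      let y := p u (consChan v.1 (consChan v.2 x.2.1), x.2.2)
      ((y.1 none, y.1 (some none)), (fun j => y.1 (some (some j))), y.2)) x.1)
    (by have := p.cont; exact WithBot.ext_cont (by fun_prop) (by fun_prop))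

/-- `⊸ R` -/
def lollyR (p : LDen U Bn Bp Dn Dp An Ap) :
    RDen U Dn Dp (.lift (.prod Bp An)) (.prod Bn Ap) :=
  .curry (fun u x => WithBot.ext (fun v : Bp × An =>
      let y := p u (v.1, x.1, v.2)
      (y.2.1, (y.1, y.2.2))) x.2)
    (by have := p.cont; exact WithBot.ext_cont (by fun_prop) (by fun_prop))

/-- `⊸ L` -/
def lollyL {B : Ty} (p : ProcDen Ψ (ext A Δ) C) :
    LDen (envDom Ψ) (.lift (.prod (B.den .pos) (A.den .neg))) (.prod (B.den .neg) (A.den .pos))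
      (chanDom (ext B Δ) .neg) (chanDom (ext B Δ) .pos) (C.den .neg) (C.den .pos) :=
  .curry (fun u x =>
    let y := split p u (x.1.2, (fun j => x.2.1 (some j)), x.2.2)
    ((((x.2.1 none, y.1) : B.den .pos × A.den .neg) : WithBot (B.den .pos × A.den .neg)),
      consChan x.1.1 y.2.1, y.2.2)) (by have := (split p).cont; fun_prop)

/-- `∧ R` -/
noncomputable def andR (M : ContMap U Bp) (p : RDen U Dn Dp An Ap) :
    RDen U Dn Dp An (.lift (.prod Bp Ap)) :=
  .curry (fun u x => strictIn (M u)
    (let y := p u x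
     (y.1, (((M u, y.2) : Bp × Ap) : WithBot (Bp × Ap)))))
    (by have := M.cont; have := p.cont; fun_prop)

/-- `∧ L` -/
def andL (p : LDen (envDom (ext τ Ψ)) An Ap Dn Dp Cn Cp) :
    LDen (envDom Ψ) An (.lift (.prod τ.den Ap)) Dn Dp Cn Cp :=
  .curry (fun u x => WithBot.ext (fun v : τ.den × Ap => p (consEnv v.1 u) (v.2, x.2)) x.1)
    (by have := p.cont; exact WithBot.ext_cont (by fun_prop) (by fun_prop))

/-- `⊃ R` -/
def impR (p : RDen (envDom (ext τ Ψ)) Dn Dp An Ap) :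
    RDen (envDom Ψ) Dn Dp (.lift (.prod τ.den An)) Ap :=
  .curry (fun u x => WithBot.ext (fun v : τ.den × An => p (consEnv v.1 u) (x.1, v.2)) x.2)
    (by have := p.cont; exact WithBot.ext_cont (by fun_prop) (by fun_prop))

/-- `⊃ L` -/
noncomputable def impL (M : ContMap U Bp) (p : LDen U An Ap Dn Dp Cn Cp) :
    LDen U (.lift (.prod Bp An)) Ap Dn Dp Cn Cp :=
  .curry (fun u x => strictIn (M u)
    (let y := p u x
     ((((M u, y.1) : Bp × An) : WithBot (Bp × An)), y.2)))
    (by have := M.cont; have := p.cont; fun_prop)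

/-- `ρ R`: the composite `(id × Fold⁺) ∘ p ∘ (id × Unfold⁻)` -/
def recR (fold : StrictMap Ap Bp) (unfold : StrictMap Bn An) (p : RDen U Dn Dp An Ap) :
    RDen U Dn Dp Bn Bp :=
  .curry (fun u x =>
    let y := p u (x.1, unfold x.2)
    (y.1, fold y.2)) (by have := p.cont; fun_prop)

/-- `ρ L`: the composite `(Fold⁻ × id) ∘ p ∘ (Unfold⁺ × id)` -/
def recL (fold : StrictMap An Bn) (unfold : StrictMap Bp Ap) (p : LDen U An Ap Dn Dp Cn Cp) :
    LDen U Bn Bp Dn Dp Cn Cp :=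
  .curry (fun u x =>
    let y := p u (unfold x.1, x.2)
    (fold y.1, y.2)) (by have := p.cont; fun_prop)

end Sem

end Operations

mutual

/-- The denotation of a term. -/
noncomputable def Tm.den : ∀ {K : Type} {Ψ : K → FType} {τ : FType}, Tm Ψ τ → TmDen Ψ τ
  | _, _, _, .var (Ψ := _) x => ⟨fun u => u x, scottContinuous_eval x⟩
  | _, _, _, .fix M => Sem.fix M.den
  | _, _, _, .lam M => Sem.lam M.den
  | _, _, _, .app M N => Sem.app M.den N.den
  | _, _, _, .quote P => Sem.quote P.den

/-- The denotation of a process. -/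
noncomputable def Proc.den : ∀ {K J : Type} {Ψ : K → FType} {Δ : J → Ty} {C : Ty},
    Proc Ψ Δ C → ProcDen Ψ Δ C
  | _, _, _, _, _, .exch e P => Sem.exch e P.den
  | _, _, _, _, _, .fwd => Sem.fwd
  | _, _, _, _, _, .cut P Q => Sem.cut P.den Q.den
  | _, _, _, _, _, .oneR => Sem.oneR
  | _, _, _, _, _, .oneL P => Sem.join (Sem.oneL P.den)
  | _, _, _, _, _, .downR P => Sem.downR P.den
  | _, _, _, _, _, .downL P => Sem.join (Sem.downL (Sem.split P.den))
  | _, _, _, _, _, .upR P => Sem.upR P.den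
  | _, _, _, _, _, .upL P => Sem.join (Sem.upL (Sem.split P.den))
  | _, _, _, _, _, .plusR k P => Sem.plusR k P.den
  | _, _, _, _, _, .plusL P => Sem.join (Sem.plusL fun l => Sem.split (P l).den)
  | _, _, _, _, _, .ampR P => Sem.ampR fun l => (P l).den
  | _, _, _, _, _, .ampL k P => Sem.join (Sem.ampL k (Sem.split P.den))
  | _, _, _, _, _, .tensorR P => Sem.join (Sem.tensorR P.den)
  | _, _, _, _, _, .tensorL P => Sem.join (Sem.tensorL P.den)
  | _, _, _, _, _, .lollyR P => Sem.lollyR (Sem.split P.den)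
  | _, _, _, _, _, .lollyL (B := B) P => Sem.join (Sem.lollyL (B := ⟨_, B⟩) P.den)
  | _, _, _, _, _, .andR M P => Sem.andR M.den P.den
  | _, _, _, _, _, .andL P => Sem.join (Sem.andL (Sem.split P.den))
  | _, _, _, _, _, .impR P => Sem.impR P.den
  | _, _, _, _, _, .impL M P => Sem.join (Sem.impL M.den (Sem.split P.den))
  | _, _, _, _, _, .recPosR (A := A) P => Sem.recR (A.fold .pos) (A.unfoldMap .neg) P.den
  | _, _, _, _, _, .recPosL (A := A) P =>
    Sem.join (Sem.recL (A.fold .neg) (A.unfoldMap .pos) (Sem.split P.den))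
  | _, _, _, _, _, .recNegR (A := A) P => Sem.recR (A.fold .pos) (A.unfoldMap .neg) P.den
  | _, _, _, _, _, .recNegL (A := A) P =>
    Sem.join (Sem.recL (A.fold .neg) (A.unfoldMap .pos) (Sem.split P.den))
  | _, _, _, _, _, .unquote M => Sem.unquote M.den

end

/-- Semantic equivalence `P ≡ Q`: equality of denotations. -/
def Proc.Equiv {K J : Type} {Ψ : K → FType} {Δ : J → Ty} {C : Ty} (P Q : Proc Ψ Δ C) : Prop :=
  P.den = Q.den

-- A cut is a feedback loop. With the environment and the external communications fixed, `P` turns a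
-- communication on `a⁻` into one on `a⁺`, and `Q` turns one on `a⁺` into one on `a⁻`. The cut runs
-- both at the least fixed point of the resulting endomap `f` of `⟦a⟧⁻ × ⟦a⟧⁺` and keeps only what
-- they emit on the remaining channels. Everything therefore comes down to comparing two least fixed
-- points.
--
-- The unfold messages transport the channel along `Fold` and `Unfold` at both ends: what either
-- process puts on `a` is wrapped by `Fold`, and what it takes from `a` is first unwrapped by
-- `Unfold`. Put `Φ = Fold⁻ × Fold⁺` and `Υ = Unfold⁻ × Unfold⁺`. The loop of the longer process is
-- then `g = Φ ∘ f ∘ Υ`, on the aspects of `ρα.A`. Since `Υ ∘ Φ = id`, the map `Φ` intertwines the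
-- loops: `g ∘ Φ = Φ ∘ f`. It is also strict and continuous, so it carries the Kleene chain of `f`
-- to that of `g`, and hence the least fixed point of `f` to that of `g`; this is
-- `ContMap.lfp_uniform`. Applying `Υ` gives `Υ (lfp g) = lfp f`. Thus `P` and `Q` receive the same
-- communications on `a` in both loops, and they emit the same communications on the other channels.
--
-- The computation is carried out in `Sem.cut_recR_recL` for an arbitrary pair of strict maps
-- `fold`, `unfold` with `unfold ∘ fold = id` in each aspect. How the recursive type is built as a
-- limit enters only through `STy.unfoldMap_fold`, which supplies this identity.

/-- Uniformity of least fixed points: a strict continuous function that intertwines `f` and `g`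
sends the least fixed point of `f` to that of `g`. -/
theorem ContMap.lfp_uniform {α β : Type*} [PartialOrder α] [PartialOrder β] [OrderBot α]
    [OrderBot β] [DCPO α] [DCPO β] (φ : StrictMap α β) {f : ContMap α α} {g : ContMap β β}
    (h : ∀ x, φ (f x) = g (φ x)) : φ f.lfp = g.lfp := by
  -- The intertwining relation moves `φ` past `n` applications of `f`, leaving `g^n (φ ⊥)`.
  -- Strictness then makes the two Kleene chains start at the same point. Without it the conclusion
  -- fails: a constant map onto a fixed point of `g` that is not least intertwines any `f` with `g`.
  have hiter : ∀ n : ℕ, φ (f.toFun^[n] ⊥) = g.toFun^[n] ⊥ := fun n =>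
    (Function.Semiconj.iterate_right (f := φ.toFun) (ga := f.toFun) (gb := g.toFun) h n ⊥).trans
      (congrArg g.toFun^[n] φ.strict)
  -- Continuity of `φ` on the Kleene chain of `f`, which is directed because it is increasing: `φ
  -- f.lfp` is the supremum of the image of this chain. By `hiter` the image is the Kleene chain of
  -- `g`, whose supremum is `g.lfp`, and suprema are unique.
  have hlub := φ.continuous (Set.range_nonempty _)
    (directedOn_range.2 f.iterate_mono.directed_le) f.lfp_isLUB
  rw [← Set.range_comp] at hlub
  have heq : φ.toFun ∘ (fun n : ℕ => f.toFun^[n] ⊥) = fun n : ℕ => g.toFun^[n] ⊥ := funext hiter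
  rw [heq] at hlub
  exact hlub.unique g.lfp_isLUB

/-- One half of the isomorphism `A.foldIso s`, evaluated at a point. Composition of morphisms of
`Dom` is written in diagrammatic order, so `hom ≫ inv` is `Fold` followed by `Unfold`. This is the
order in which a communication meets the two maps inside a cut: the sending side folds it and the
receiving side unfolds it, in the direction of `a⁺` as well as in that of `a⁻`. -/
theorem STy.unfoldMap_fold {p : Pol} (A : STy [p] p) (s : Pol)
    (x : Ty.den ⟨p, A.unfold⟩ s) : A.unfoldMap s (A.fold s x) = x :=
  congrArg (fun f : StrictMap (Ty.den ⟨p, A.unfold⟩ s) (Ty.den ⟨p, A.unfold⟩ s) => f x)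
    (A.foldIso s).hom_inv_id

namespace Sem

/-- A cut is unchanged if the cut channel is transported along a retraction. -/
theorem cut_recR_recL {K J₁ J₂ : Type} {Ψ : K → FType} {Δ₁ : J₁ → Ty} {Δ₂ : J₂ → Ty} {A B C : Ty}
    (fold : ∀ s, StrictMap (A.den s) (B.den s)) (unfold : ∀ s, StrictMap (B.den s) (A.den s))
    (h : ∀ s x, unfold s (fold s x) = x) (p : ProcDen Ψ Δ₁ A) (q : ProcDen Ψ (ext A Δ₂) C) :
    cut (A := B) (recR (fold .pos) (unfold .neg) p)
      (join (recL (fold .neg) (unfold .pos) (split q))) = cut p q := by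
  -- Denotations are compared at an environment `u` and an external communication `x`: `x.1` is the
  -- positive communication on the channels of both contexts, `x.2` the negative one on the provided
  -- channel. These stay fixed, so that the trace becomes an ordinary least fixed point.
  refine ContMap.ext (funext fun u => ContMap.ext (funext fun x => ?_))
  -- The two processes as functions of the cut channel alone. `P` depends on `a⁻`, and its second
  -- component is the `a⁺` that it emits; `Q` depends on `a⁺`, and its first component is the `a⁻`
  -- that it sends back. The other components are the external output.
  let P (a : A.den .neg) := p u (fun j => x.1 (Sum.inl j), a)
  let Q (a : A.den .pos) := split q u (a, fun j => x.1 (Sum.inr j), x.2)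
  have hP : ScottContinuous P := by have := p.cont; fun_prop
  have hQ : ScottContinuous Q := by have := (split q).cont; fun_prop
  -- The feedback map of the original cut. The wires cross: the new `a⁻` is computed by `Q` from the
  -- old `a⁺`, and the new `a⁺` by `P` from the old `a⁻`.
  let f : ContMap (A.den .neg × A.den .pos) (A.den .neg × A.den .pos) :=
    ⟨fun z => ((Q z.2).1, (P z.1).2), by fun_prop⟩
  -- The feedback map of the transported cut, which is `f` preceded by `unfold` and followed by
  -- `fold` in both aspects.
  let g : ContMap (B.den .neg × B.den .pos) (B.den .neg × B.den .pos) :=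
    ⟨fun z => (fold .neg (Q (unfold .pos z.2)).1, fold .pos (P (unfold .neg z.1)).2), by fun_prop⟩
  -- The intertwining map is `fold` in both aspects at once, which is strict because each factor is.
  -- Going from `f` to `g` with `fold`, instead of from `g` to `f` with `unfold`, places `unfold`
  -- directly after `fold` in `g ∘ Φ`, so that `unfold ∘ fold = id` is the identity required.
  have key : (StrictMap.prodMap (fold .neg) (fold .pos)) f.lfp = g.lfp :=
    ContMap.lfp_uniform _ fun z => by
      change (fold .neg (Q z.2).1, fold .pos (P z.1).2) =
        (fold .neg (Q (unfold .pos (fold .pos z.2))).1,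
          fold .pos (P (unfold .neg (fold .neg z.1))).2)
      -- The right-hand side contains `unfold (fold _)` twice, once for each direction of the
      -- channel; cancelling both leaves `Φ (f z)`.
      rw [h, h]
  -- Both traces unfold by definition to the external outputs of `P` and `Q` at the respective fixed
  -- point. On the left, the `split` inside `cut` cancels the `join` around `recL`, since isolating
  -- the channel just adjoined to a context returns the original components. The external outputs
  -- are not wrapped by `fold`, and `P` and `Q` are evaluated at the unfolded fixed point of `g`; so
  -- it remains to identify `unfold` of `g.lfp` with `f.lfp`, one aspect at a time.
  change (sumChan (P (unfold .neg g.lfp.1)).1 (Q (unfold .pos g.lfp.2)).2.1,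
      (Q (unfold .pos g.lfp.2)).2.2) =
    (sumChan (P f.lfp.1).1 (Q f.lfp.2).2.1, (Q f.lfp.2).2.2)
  -- By `key`, each component of `g.lfp` is `fold` of the matching component of `f.lfp`, and
  -- `unfold` removes that `fold`.
  have h1 : unfold .neg g.lfp.1 = f.lfp.1 :=
    (congrArg (fun z => unfold .neg z.1) key.symm).trans (h .neg _)
  have h2 : unfold .pos g.lfp.2 = f.lfp.2 :=
    (congrArg (fun z => unfold .pos z.2) key.symm).trans (h .pos _)
  rw [h1, h2]

end Sem

theorem mainTheorem7 {K J₁ J₂ : Type} (Ψ : K → FType) (Δ₁ : J₁ → Ty) (Δ₂ : J₂ → Ty)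
    (A : STy [.pos] .pos) (C : Ty) (P : Proc Ψ Δ₁ ⟨.pos, A.unfold⟩)
    (Q : Proc Ψ (ext ⟨.pos, A.unfold⟩ Δ₂) C) :
    Proc.Equiv (.cut P Q) (.cut (.recPosR P) (.recPosL Q)) := by
  -- On denotations, `recPosR` carries `Fold⁺` and `Unfold⁻`, and `recPosL` carries `Fold⁻` and
  -- `Unfold⁺`. Together they supply one fold–unfold pair for each aspect of the cut channel, as
  -- `Sem.cut_recR_recL` requires, with `[ρα.A/α]A` as its type `A` and `ρα.A` as its type `B`.
  simp only [Proc.Equiv, Proc.den]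
  exact (Sem.cut_recR_recL A.fold A.unfoldMap A.unfoldMap_fold P.den Q.den).symm
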